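/- Let $K$ be an algebraically closed field of characteristic $0$. Let $B\subset\mathbb{G}(k,N)$ be an irreducible closed subvariety of dimension $n$, $n\le N-k$, of the Grassmannian of $k$-dimensional linear subspaces of $\mathbb{P}^N_K$, and let $X\subset\mathbb{P}^N$ be the union of the $k$-spaces belonging to $B$. Let $B'\to B$ be a desingularization (with $B'$ projective), let $\mathcal{I}=\{(b,x)\in B'\times\mathbb{P}^N : x\in\Lambda_b\}$ be the incidence correspondence, where $\Lambda_b$ denotes the $k$-space corresponding to the image of $b$ in $B$, and let $g:\mathcal{I}\to B$ and $f:\mathcal{I}\to\mathbb{P}^N$ be the natural maps. The characteristic map at $q=(b,x)\in\mathcal{I}$ is the linear map $$\chi_q:\ T_bB'\longrightarrow T_q(B'\times\mathbb{P}^N)/T_q\mathcal{I},\qquad \tau\mapsto[(\tau,0)].$$ Let $V(\chi)\subset\mathcal{I}$ be the set of the points $q$ at which $\operatorname{rank}\chi_q<\min\{n,N-k\}$. The focal locus is $F=f(V(\chi))\subset\mathbb{P}^N$, with its reduced structure; the points $x$ with $(b,x)\in V(\chi)$ are the focal points on $\Lambda_b$. The fundamental locus $\Phi$ is the set of the points $x$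 whose fibre $f^{-1}(x)$ has positive dimension. Suppose that $\dim X=n+k$ and that the focal locus has codimension $1$ in $X$, in the following sense: $\dim F=n+k-1$, and $\dim f(W)=n+k-1$ for every irreducible component $W$ of $V(\chi)$ such that $g(W)$ is dense in $B$ and $f(W)\not\subset\Phi$. Then a general $\Lambda\in B$ is tangent to $F$ at all focal points on $\Lambda$ that are not fundamental: there is a non-empty open subset $O$ of $B$ such that, for every $\Lambda\in O$, every $b\in B'$ with $\Lambda_b=\Lambda$, and every $x\in\Lambda$ with $(b,x)\in V(\chi)$ and $x\notin\Phi$, the space $\Lambda$ is contained in the embedded (Zariski) tangent space $\mathbb{T}_xF\subset\mathbb{P}^N$. -/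

import Mathlib

noncomputable section

namespace Focal

open Module MvPolynomial

/-! ### Affine space -/

/-- The Zariski topology on the affine space `K^ι`: the closed sets are the common zero sets of
families of polynomials. -/
@[reducible] def zariski (K : Type*) [Field K] (ι : Type*) : TopologicalSpace (ι → K) :=
  TopologicalSpace.ofClosed
    {Z | ∃ S : Set (MvPolynomial ι K), Z = {v | ∀ p ∈ S, eval v p = 0}}
    ⟨{1}, by ext v; simp⟩
    (by
      intro A hA
      refine ⟨{p | ∃ Z ∈ A, ∀ v ∈ Z, eval v p = 0}, ?_⟩
      ext v
      constructor
      · intro hv p hp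
        obtain ⟨Z, hZ, hp⟩ := hp
        exact hp v (hv Z hZ)
      · intro hv Z hZ
        obtain ⟨S, rfl⟩ := hA hZ
        exact fun p hp => hv p ⟨_, hZ, fun w hw => hw p hp⟩)
    (by
      rintro Z ⟨S, rfl⟩ Z' ⟨S', rfl⟩
      refine ⟨{r | ∃ p ∈ S, ∃ q ∈ S', r = p * q}, ?_⟩
      ext v
      constructor
      · rintro (hv | hv) r ⟨p, hp, q, hq, rfl⟩
        · simp [hv p hp]
        · simp [hv q hq]
      · intro hv
        by_contra hcon
        simp only [Set.mem_union, Set.mem_ofPred_eq, not_or, not_forall] at hcon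
        obtain ⟨⟨p, hp, hp0⟩, q, hq, hq0⟩ := hcon
        have h := hv (p * q) ⟨p, hp, q, hq, rfl⟩
        rw [map_mul] at h
        exact (mul_ne_zero hp0 hq0) h)

/-- The Zariski tangent space at `v` of the (reduced) closed subset of `K^ι` defined by all
polynomials that vanish on `C`, as a linear subspace of `K^ι`. -/
def zariskiTangent {K : Type*} [Field K] {ι : Type*} [Fintype ι] (C : Set (ι → K)) (v : ι → K) :
    Submodule K (ι → K) where
  carrier := {w | ∀ p : MvPolynomial ι K, (∀ c ∈ C, eval c p = 0) →
    ∑ i, w i * eval v (pderiv i p) = 0}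
  zero_mem' := by intro p _; simp
  add_mem' := by
    intro w w' hw hw' p hp
    simp [add_mul, Finset.sum_add_distrib, hw p hp, hw' p hp]
  smul_mem' := by
    intro a w hw p hp
    simp [mul_assoc, ← Finset.mul_sum, hw p hp]

/-! ### Projective space, products of two projective spaces, Grassmannians -/

/-- The projective space of dimension `N` over `K`. -/
abbrev ProjSpace (K : Type*) [Field K] (N : ℕ) : Type _ :=
  Projectivization K (Fin (N + 1) → K)

/-- The Zariski topology on projective space, as a quotient of `K^(N+1)` without the origin. -/
instance ProjSpace.instTopologicalSpace (K : Type*) [Field K] (N : ℕ) :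
    TopologicalSpace (ProjSpace K N) :=
  TopologicalSpace.coinduced
    (fun v : {v : Fin (N + 1) → K // v ≠ 0} => Projectivization.mk K v.1 v.2)
    (TopologicalSpace.induced Subtype.val (zariski K (Fin (N + 1))))

/-- The product variety `ℙ^M × ℙ^N`. A definition of its own, because its Zariski topology is not
the product topology. -/
def BiProjSpace (K : Type*) [Field K] (M N : ℕ) : Type _ :=
  ProjSpace K M × ProjSpace K N

/-- The Zariski topology on `ℙ^M × ℙ^N` (closed sets are given by bihomogeneous equations), as a
quotient of the set of the pairs of non-zero vectors. -/
instance BiProjSpace.instTopologicalSpace (K : Type*) [Field K] (M N : ℕ) :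
    TopologicalSpace (BiProjSpace K M N) :=
  TopologicalSpace.coinduced
    (fun z : {z : (Fin (M + 1) → K) × (Fin (N + 1) → K) // z.1 ≠ 0 ∧ z.2 ≠ 0} =>
      ((Projectivization.mk K z.1.1 z.2.1, Projectivization.mk K z.1.2 z.2.2) :
        BiProjSpace K M N))
    (TopologicalSpace.induced (fun z => Sum.elim z.1.1 z.1.2)
      (zariski K (Fin (M + 1) ⊕ Fin (N + 1))))

/-- The Grassmannian of the `k`-dimensional projective subspaces of `ℙ^N`, that is of the linear
subspaces of dimension `k + 1` of `K^(N+1)`. -/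
def Grass (K : Type*) [Field K] (N k : ℕ) : Type _ :=
  {L : Submodule K (Fin (N + 1) → K) // finrank K L = k + 1}

/-- Frames: linearly independent families of `k + 1` vectors of `K^(N+1)`. -/
abbrev Frame (K : Type*) [Field K] (N k : ℕ) : Type _ :=
  {A : Fin (k + 1) → Fin (N + 1) → K // LinearIndependent K A}

/-- The matrix entries of a family of vectors, as one point of an affine space. -/
def entries {K : Type*} {N k : ℕ} (A : Fin (k + 1) → Fin (N + 1) → K) :
    Fin (k + 1) × Fin (N + 1) → K :=
  fun ij => A ij.1 ij.2

/-- The point of the Grassmannian spanned by a frame. -/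
def Frame.span {K : Type*} [Field K] {N k : ℕ} (A : Frame K N k) : Grass K N k :=
  ⟨Submodule.span K (Set.range A.1), by rw [finrank_span_eq_card A.2]; simp⟩

/-- The Zariski topology on the Grassmannian, as the quotient of the space of frames (an open
subset of the affine space of matrices) by the change of frame. -/
instance Grass.instTopologicalSpace (K : Type*) [Field K] (N k : ℕ) :
    TopologicalSpace (Grass K N k) :=
  TopologicalSpace.coinduced (Frame.span : Frame K N k → Grass K N k)
    (TopologicalSpace.induced (fun A => entries A.1) (zariski K (Fin (k + 1) × Fin (N + 1))))

/-- The point `x` of `ℙ^N` lies on the projective subspace `L`. -/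
def Grass.Contains {K : Type*} [Field K] {N k : ℕ} (L : Grass K N k) (x : ProjSpace K N) : Prop :=
  x.submodule ≤ L.1

/-- The affine cone (without the origin) over a subset of `ℙ^N`. -/
def cone {K : Type*} [Field K] {N : ℕ} (Z : Set (ProjSpace K N)) : Set (Fin (N + 1) → K) :=
  {v | ∃ h : v ≠ 0, Projectivization.mk K v h ∈ Z}

/-- The affine bicone (without the pairs with a zero component) over a subset of `ℙ^M × ℙ^N`. -/
def bicone {K : Type*} [Field K] {M N : ℕ} (Z : Set (BiProjSpace K M N)) :
    Set (Fin (M + 1) ⊕ Fin (N + 1) → K) :=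
  {z | ∃ (u : Fin (M + 1) → K) (v : Fin (N + 1) → K) (hu : u ≠ 0) (hv : v ≠ 0),
    z = Sum.elim u v ∧
      ((Projectivization.mk K u hu, Projectivization.mk K v hv) : BiProjSpace K M N) ∈ Z}

/-- The embedded tangent space at `x` of a closed subset `Z` of `ℙ^N` (with its reduced
structure), as a linear subspace of `K^(N+1)`: the Zariski tangent space of the affine cone. It is
independent of the representative of `x`, and the tangent space `T_x Z` is its quotient by the line
`x`. -/
def embTangent {K : Type*} [Field K] {N : ℕ} (Z : Set (ProjSpace K N)) (x : ProjSpace K N) :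
    Submodule K (Fin (N + 1) → K) :=
  zariskiTangent (cone Z) x.rep

/-- The closed subset `Y` of `ℙ^M` is non-singular (of the same dimension at all its points). -/
def IsNonsingular {K : Type*} [Field K] {M : ℕ} (Y : Set (ProjSpace K M)) : Prop :=
  ∀ y ∈ Y, ((finrank K (embTangent Y y) : ℕ) : WithBot ℕ∞) = topologicalKrullDim Y + 1

/-! ### Regular maps to and from a Grassmannian -/

/-- A map from a subset of `ℙ^M` to a Grassmannian is regular if around every point it is given by
a frame whose entries are homogeneous polynomials of one and the same degree. -/
def IsRegularToGrass {K : Type*} [Field K] {M N k : ℕ} {Y : Set (ProjSpace K M)}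
    (φ : Y → Grass K N k) : Prop :=
  ∀ y : Y, ∃ (d : ℕ) (A : Fin (k + 1) → Fin (N + 1) → MvPolynomial (Fin (M + 1)) K),
    (∀ i j, (A i j).IsHomogeneous d) ∧
    LinearIndependent K (fun i j => eval y.1.rep (A i j)) ∧
    ∀ (z : Y) (h : LinearIndependent K (fun i j => eval z.1.rep (A i j))),
      φ z = Frame.span ⟨_, h⟩

/-- A map from a subset of a Grassmannian to `ℙ^M` is regular if around every point its homogeneous
coordinates are polynomials in the entries of a frame. -/
def IsRegularFromGrass {K : Type*} [Field K] {M N k : ℕ} {S : Set (Grass K N k)}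
    (ψ : S → ProjSpace K M) : Prop :=
  ∀ A₀ : Frame K N k, A₀.span ∈ S →
    ∃ P : Fin (M + 1) → MvPolynomial (Fin (k + 1) × Fin (N + 1)) K,
      (fun j => eval (entries A₀.1) (P j)) ≠ 0 ∧
      ∀ (A : Frame K N k) (hA : A.span ∈ S) (hP : (fun j => eval (entries A.1) (P j)) ≠ 0),
        ψ ⟨A.span, hA⟩ = Projectivization.mk K (fun j => eval (entries A.1) (P j)) hP

/-- A desingularization of a closed subvariety `B` of a Grassmannian: a non-singular projective
variety `B'` with a surjective birational morphism to `B`. -/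
structure Desingularization {K : Type*} [Field K] {N k : ℕ} (B : Set (Grass K N k)) where
  /-- The dimension of a projective space containing `B'`. -/
  M : ℕ
  /-- The variety `B'`. -/
  carrier : Set (ProjSpace K M)
  isClosed_carrier : IsClosed carrier
  isIrreducible_carrier : IsIrreducible carrier
  nonsingular : IsNonsingular carrier
  /-- The morphism from `B'` to `B`. -/
  toGrass : carrier → Grass K N k
  regular : IsRegularToGrass toGrass
  range_eq : Set.range toGrass = B
  /-- There is a regular inverse over a non-empty open subset of `B`. -/
  birational : ∃ O : Set (Grass K N k), IsOpen O ∧ (B ∩ O).Nonempty ∧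
    ∃ σ : (B ∩ O : Set (Grass K N k)) → ProjSpace K M, IsRegularFromGrass σ ∧
      ∀ (y : carrier) (hy : toGrass y ∈ B ∩ O), σ ⟨toGrass y, hy⟩ = y.1

/-! ### Families of linear spaces and their foci -/

/-- The union of the projective subspaces that belong to `B`. -/
def sweptOut {K : Type*} [Field K] {N k : ℕ} (B : Set (Grass K N k)) : Set (ProjSpace K N) :=
  {x | ∃ L ∈ B, L.Contains x}

namespace Desingularization

variable {K : Type*} [Field K] {N k : ℕ} {B : Set (Grass K N k)}

/-- The incidence correspondence `I` in `B' × ℙ^N`. -/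
def incidence (D : Desingularization B) : Set (BiProjSpace K D.M N) :=
  {q | ∃ h : q.1 ∈ D.carrier, (D.toGrass ⟨q.1, h⟩).Contains q.2}

/-- The fundamental locus: the points `x` over which the fibre of `f : I → ℙ^N` (that is, the set
of the `b` in `B'` whose linear space contains `x`) has positive dimension. -/
def fundamentalLocus (D : Desingularization B) : Set (ProjSpace K N) :=
  {x | 0 < topologicalKrullDim
    {b : ProjSpace K D.M | ∃ h : b ∈ D.carrier, (D.toGrass ⟨b, h⟩).Contains x}}

/-- The tangent space of the bicone over `I` at (representatives of) `q`. Its quotient by the span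
of the two lines of `q` is the tangent space `T_q I`. -/
def incidenceTangent (D : Desingularization B) (q : BiProjSpace K D.M N) :
    Submodule K (Fin (D.M + 1) ⊕ Fin (N + 1) → K) :=
  zariskiTangent (bicone D.incidence) (Sum.elim q.1.rep q.2.rep)

/-- The characteristic map at `q = (b, x)`: it sends a vector tangent to `B'` at `b`, regarded as
a vector `(τ, 0)` tangent to `B' × ℙ^N` at `q`, to its class modulo `T_q I`.
It is written on the affine cones: the source is `T_b B'` enlarged by the line `b`, on which the
map vanishes, and the target contains the normal space `T_q (B' × ℙ^N) / T_q I`, in which the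
values lie; so the rank is that of the characteristic map. -/
def characteristicMap (D : Desingularization B) (q : BiProjSpace K D.M N) :
    embTangent D.carrier q.1 →ₗ[K]
      ((Fin (D.M + 1) ⊕ Fin (N + 1) → K) ⧸ D.incidenceTangent q) :=
  (D.incidenceTangent q).mkQ ∘ₗ
    ((LinearEquiv.sumArrowLequivProdArrow (Fin (D.M + 1)) (Fin (N + 1)) K K).symm.toLinearMap ∘ₗ
      LinearMap.inl K (Fin (D.M + 1) → K) (Fin (N + 1) → K)) ∘ₗ
    (embTangent D.carrier q.1).subtype

/-- The (support of the) subscheme of foci in `I`: the points at which the rank of the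
characteristic map is less than the minimum of the rank `dim T_b B'` of the pulled back tangent
bundle and the rank `N - k` of the normal bundle. -/
def foci (D : Desingularization B) : Set (BiProjSpace K D.M N) :=
  {q | q ∈ D.incidence ∧ finrank K (LinearMap.range (D.characteristicMap q)) <
    min (finrank K (embTangent D.carrier q.1) - 1) (N - k)}

/-- The image in `ℙ^N` of a subset of `B' × ℙ^N`. -/
def imageInSpace (D : Desingularization B) (W : Set (BiProjSpace K D.M N)) :
    Set (ProjSpace K N) :=
  {x | ∃ q ∈ W, q.2 = x}

/-- The image in `B` of a subset of `B' × ℙ^N`. -/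
def imageInBase (D : Desingularization B) (W : Set (BiProjSpace K D.M N)) :
    Set (Grass K N k) :=
  {L | ∃ q ∈ W, ∃ h : q.1 ∈ D.carrier, D.toGrass ⟨q.1, h⟩ = L}

/-- The focal locus in `ℙ^N`. -/
def focalLocus (D : Desingularization B) : Set (ProjSpace K N) :=
  D.imageInSpace D.foci

/-- `W` is an irreducible component of the set of foci in `I`. -/
def IsFocalComponent (D : Desingularization B) (W : Set (BiProjSpace K D.M N)) : Prop :=
  Maximal (fun Z : Set (BiProjSpace K D.M N) => IsIrreducible Z ∧ Z ⊆ D.foci) W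

end Desingularization

end Focal

end

/-!
Everything is computed on affine cones. At a point `q = (b, x)` of the incidence correspondence `I`,
the kernel of the characteristic map is that of the projection of `T_q I` to `K^(N+1)`, so at a
focus the image of `T_q I` in `K^(N+1)` has dimension at most `n + k`. This image contains the
linear space `Λ_b`.

Let `W` be an irreducible set of foci whose image in `ℙ^N` has dimension at least `n + k - 1`. Since
`K` has characteristic zero, for general `q = (b, x)` in `W` the map from `T_q W` to the tangent
space of the image is surjective, so the image of `T_q W` in `K^(N+1)` has dimension at least
`n + k`. It is contained in the image of `T_q I`, and therefore the two agree: `Λ_b` is contained in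
the image of `T_q W`, which is contained in `T_x F`. This is a closed condition on `q`, so it holds
at every point of `W`, not only at a general one.

Finally, the foci have only finitely many irreducible components, and the components that do not
dominate `B` can be avoided by shrinking the open set.
-/

noncomputable section

namespace Focal

open Module MvPolynomial
open scoped Matrix

/-! ### Derivations and tangent vectors -/

theorem derivation_aeval_eq_sum {R A M σ : Type*} [CommRing R] [CommRing A] [Algebra R A]
    [AddCommGroup M] [Module A M] [Module R M] [Fintype σ] (D : Derivation R A M) (y : σ → A)
    (p : MvPolynomial σ R) : D (aeval y p) = ∑ s, aeval y (pderiv s p) • D (y s) := by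
  classical
  induction p using MvPolynomial.induction_on with
  | C a => simp
  | add p q hp hq => simp only [map_add, hp, hq, add_smul, Finset.sum_add_distrib]
  | mul_X p t hp =>
    simp only [Derivation.leibniz, map_mul, map_add, smul_eq_mul, aeval_X, pderiv_X,
      Pi.single_apply, hp, add_smul, mul_smul, Finset.sum_add_distrib, Finset.smul_sum,
      apply_ite (aeval y), map_one, map_zero, ite_smul, one_smul, zero_smul, smul_ite, smul_zero,
      Finset.sum_ite_eq', Finset.mem_univ, if_true, eq_comm (a := t)]

theorem formallyEtale_of_isAlgebraic {A L : Type*} [CommRing A] [IsDomain A] [Field L]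
    [CharZero L] [Algebra A L] [FaithfulSMul A L] [Algebra.IsAlgebraic A L] :
    Algebra.FormallyEtale A L := by
  let F := FractionRing A
  let : Algebra F L := FractionRing.liftAlgebra _ _
  have : IsScalarTower A F L := FractionRing.isScalarTower_liftAlgebra _ _
  have : Algebra.IsAlgebraic F L :=
    Algebra.IsAlgebraic.extendScalars (IsFractionRing.injective A F)
  have : CharZero F := (RingHom.charZero_iff (algebraMap F L).injective).2 inferInstance
  have : Algebra.FormallyEtale A F := Algebra.FormallyEtale.of_isLocalization (nonZeroDivisors A)
  have : Algebra.FormallyEtale F L := Algebra.FormallyEtale.of_isSeparable F L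
  exact Algebra.FormallyEtale.comp A F L

theorem exists_derivation_algebraMap_eq {R A B : Type*} [CommRing R] [CommRing A] [CommRing B]
    [Algebra R A] [Algebra R B] [Algebra A B] [IsScalarTower R A B] [Algebra.FormallyEtale A B]
    (d : Derivation R A B) : ∃ D : Derivation R B B, ∀ a, D (algebraMap A B a) = d a :=
  ⟨(d.liftKaehlerDifferential.liftBaseChange B ∘ₗ
      (KaehlerDifferential.tensorKaehlerEquivOfFormallyEtale R A B).symm.toLinearMap).compDer
        (KaehlerDifferential.D R B), fun a => by
    simp [KaehlerDifferential.tensorKaehlerEquivOfFormallyEtale_symm_D_algebraMap]⟩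

section DualDerivations

variable {K L ι : Type*} [Field K] [Field L] [CharZero L] [Algebra K L] [DecidableEq ι] {x : ι → L}

theorem exists_derivation_dual_of_isTranscendenceBasis (hx : IsTranscendenceBasis K x) :
    ∃ D : ι → Derivation K L L, ∀ i j, D i (x j) = if i = j then 1 else 0 := by
  let : Algebra (MvPolynomial ι K) L := (aeval x).toAlgebra
  have hmap (p : MvPolynomial ι K) : algebraMap (MvPolynomial ι K) L p = aeval x p := rfl
  have : IsScalarTower K (MvPolynomial ι K) L := .of_algebraMap_eq fun r => by simp [hmap]
  have : FaithfulSMul (MvPolynomial ι K) L := (faithfulSMul_iff_algebraMap_injective _ _).2 hx.1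
  have : Algebra.IsAlgebraic (MvPolynomial ι K) L := by
    have := hx.isAlgebraic
    refine .of_ringHom_of_comp_eq (S := Algebra.adjoin K (Set.range x))
      (hx.1.aevalEquiv : MvPolynomial ι K →+* Algebra.adjoin K (Set.range x)) (RingHom.id L)
      hx.1.aevalEquiv.surjective Function.injective_id (RingHom.ext fun p => ?_)
    simp [hmap]
  have := formallyEtale_of_isAlgebraic (A := MvPolynomial ι K) (L := L)
  choose D hD using fun i : ι => exists_derivation_algebraMap_eq
    (mkDerivation K fun j => if i = j then (1 : L) else 0)
  refine ⟨D, fun i j => ?_⟩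
  rw [← mkDerivation_X K (fun j => if i = j then (1 : L) else 0), ← hD, hmap, aeval_X]

theorem exists_derivation_dual (hx : AlgebraicIndependent K x) :
    ∃ D : ι → Derivation K L L, ∀ i j, D i (x j) = if i = j then 1 else 0 := by
  classical
  obtain ⟨t, hxt, ht⟩ := exists_isTranscendenceBasis_superset
    (s := Set.range x) ((algebraicIndependent_subtype_range hx.injective).2 hx)
  obtain ⟨D, hD⟩ := exists_derivation_dual_of_isTranscendenceBasis ht
  refine ⟨fun i => D ⟨x i, hxt ⟨i, rfl⟩⟩, fun i j => ?_⟩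
  simpa [hx.injective.eq_iff] using hD ⟨x i, hxt ⟨i, rfl⟩⟩ ⟨x j, hxt ⟨j, rfl⟩⟩

end DualDerivations

section GenericPoint

variable {K σ : Type*} [Field K] (P : Ideal (MvPolynomial σ K))

/-- The generic point of the affine variety with prime ideal `P`, with coordinates in its function
field. -/
def genericPoint (s : σ) : FractionRing (MvPolynomial σ K ⧸ P) :=
  algebraMap (MvPolynomial σ K ⧸ P) _ (Ideal.Quotient.mk P (X s))

theorem aeval_genericPoint (p : MvPolynomial σ K) :
    aeval (genericPoint P) p = algebraMap (MvPolynomial σ K ⧸ P) _ (Ideal.Quotient.mk P p) := by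
  have : aeval (genericPoint P) =
      (IsScalarTower.toAlgHom K (MvPolynomial σ K ⧸ P) (FractionRing _)).comp
        (Ideal.Quotient.mkₐ K P) := by
    ext s
    simp [genericPoint]
  rw [this]
  rfl

variable {P} in
theorem aeval_genericPoint_eq_zero_iff {p : MvPolynomial σ K} :
    aeval (genericPoint P) p = 0 ↔ p ∈ P := by
  rw [aeval_genericPoint, map_eq_zero_iff _ (IsFractionRing.injective _ _),
    Ideal.Quotient.eq_zero_iff_mem]

variable [P.IsPrime]

theorem exists_aeval_genericPoint_eq_mul {τ : Type*} [Finite τ]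
    (f : τ → FractionRing (MvPolynomial σ K ⧸ P)) :
    ∃ H ∉ P, ∃ w : τ → MvPolynomial σ K,
      ∀ t, aeval (genericPoint P) (w t) = aeval (genericPoint P) H * f t := by
  obtain ⟨b, hb⟩ := IsLocalization.exist_integer_multiples_of_finite
    (nonZeroDivisors (MvPolynomial σ K ⧸ P)) f
  choose a ha using hb
  choose w hw using fun t => Ideal.Quotient.mk_surjective (a t)
  obtain ⟨H, hH⟩ := Ideal.Quotient.mk_surjective (b : MvPolynomial σ K ⧸ P)
  refine ⟨H, fun hHP => nonZeroDivisors.ne_zero b.2 ?_, w, fun t => ?_⟩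
  · rw [← hH, Ideal.Quotient.eq_zero_iff_mem.2 hHP]
  · rw [aeval_genericPoint, aeval_genericPoint, hw, hH, ha, Algebra.smul_def]

theorem exists_tangent_vectors [CharZero K] [Fintype σ] {ι : Type*} [Finite ι]
    [DecidableEq ι] (x : ι → σ)
    (hx : AlgebraicIndependent K fun i => Ideal.Quotient.mk P (X (x i))) :
    ∃ H ∉ P, ∃ w : ι → σ → MvPolynomial σ K,
      (∀ i j, w i (x j) - (if i = j then H else 0) ∈ P) ∧
      ∀ i, ∀ p ∈ P, ∑ s, w i s * pderiv s p ∈ P := by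
  have : CharZero (FractionRing (MvPolynomial σ K ⧸ P)) :=
    charZero_of_injective_algebraMap (algebraMap K _).injective
  have hxy : AlgebraicIndependent K fun i => genericPoint P (x i) :=
    hx.map' (f := IsScalarTower.toAlgHom K (MvPolynomial σ K ⧸ P) (FractionRing _))
      (IsFractionRing.injective _ _)
  obtain ⟨D, hD⟩ := exists_derivation_dual hxy
  obtain ⟨H, hH, w, hw⟩ :=
    exists_aeval_genericPoint_eq_mul P fun q : ι × σ => D q.1 (genericPoint P q.2)
  refine ⟨H, hH, fun i s => w (i, s), fun i j => ?_, fun i p hp => ?_⟩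
  · rw [← aeval_genericPoint_eq_zero_iff, map_sub, hw, hD]
    split_ifs <;> simp
  · have h : ∑ s, aeval (genericPoint P) (pderiv s p) * D i (genericPoint P s) = 0 := by
      simpa [aeval_genericPoint_eq_zero_iff.2 hp] using
        (derivation_aeval_eq_sum (D i) (genericPoint P) p).symm
    rw [← aeval_genericPoint_eq_zero_iff, map_sum]
    simp only [map_mul, hw, mul_assoc, mul_comm (D i _), ← Finset.mul_sum, h, mul_zero]

end GenericPoint

/-! ### Krull dimension of finitely generated algebras -/

theorem ringKrullDim_eq_of_isIntegral_of_injective {R S : Type*} [CommRing R] [CommRing S]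
    [Algebra R S] [Algebra.IsIntegral R S] (h : Function.Injective (algebraMap R S)) :
    ringKrullDim S = ringKrullDim R := by
  refine le_antisymm ?_ (iSup_le fun l => ?_)
  · refine Order.krullDim_le_of_strictMono (PrimeSpectrum.comap (algebraMap R S)) fun p q hpq => ?_
    obtain ⟨x, hxq, hxp⟩ := SetLike.exists_of_lt (show p.asIdeal < q.asIdeal from hpq)
    exact Ideal.comap_lt_comap_of_integral_mem_sdiff hpq.le ⟨hxq, hxp⟩
      (Algebra.IsIntegral.isIntegral x)
  · have : FaithfulSMul R S := (faithfulSMul_iff_algebraMap_injective R S).2 h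
    obtain ⟨Q, -, hQ, hQl⟩ := Ideal.exists_ideal_over_prime_of_isIntegral l.head.asIdeal
      (⊥ : Ideal S) (by simp [← RingHom.ker_eq_comap_bot])
    have : Q.LiesOver l.head.asIdeal := ⟨hQl.symm⟩
    obtain ⟨M, hM, -⟩ := Ideal.exists_ltSeries_of_hasGoingUp l Q
    exact hM ▸ Order.LTSeries.length_le_krullDim M

section FiniteType

variable (K : Type*) {A : Type*} [Field K] [CommRing A] [IsDomain A] [Algebra K A]
  [Algebra.FiniteType K A]

variable (A) in
theorem exists_isTranscendenceBasis_and_ringKrullDim_eq :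
    ∃ (s : ℕ) (x : Fin s → A), IsTranscendenceBasis K x ∧ ringKrullDim A = s := by
  obtain ⟨s, g, hg, hint⟩ := exists_integral_inj_algHom_of_fg K A
  let : Algebra (MvPolynomial (Fin s) K) A := g.toRingHom.toAlgebra
  have : IsScalarTower K (MvPolynomial (Fin s) K) A :=
    .of_algebraMap_eq fun r => (g.commutes r).symm
  have : Algebra.IsIntegral (MvPolynomial (Fin s) K) A := ⟨hint⟩
  have : FaithfulSMul (MvPolynomial (Fin s) K) A :=
    (faithfulSMul_iff_algebraMap_injective _ _).2 hg
  refine ⟨s, _, (IsTranscendenceBasis.mvPolynomial (Fin s) K).algebraMap_comp, ?_⟩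
  rw [ringKrullDim_eq_of_isIntegral_of_injective hg]
  simp

variable {K}

theorem ringKrullDim_eq_of_isTranscendenceBasis {ι : Type*} {x : ι → A}
    (hx : IsTranscendenceBasis K x) : ringKrullDim A = Nat.card ι := by
  obtain ⟨s, y, hy, hdim⟩ := exists_isTranscendenceBasis_and_ringKrullDim_eq K A
  have hcard : Nat.card ι = s := by
    simpa [Nat.card] using congrArg Cardinal.toNat (hx.lift_cardinalMk_eq hy)
  rw [hdim, hcard]

end FiniteType

theorem ringKrullDim_localizationAway (K : Type*) {A : Type*} [Field K] [CommRing A] [IsDomain A]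
    [Algebra K A] [Algebra.FiniteType K A] {h : A} (hh : h ≠ 0) :
    ringKrullDim (Localization.Away h) = ringKrullDim A := by
  have hle : Submonoid.powers h ≤ nonZeroDivisors A :=
    powers_le_nonZeroDivisors_of_noZeroDivisors hh
  have : IsDomain (Localization.Away h) := IsLocalization.isDomain_localization hle
  have : Algebra.FiniteType A (Localization.Away h) :=
    IsLocalization.finiteType_of_monoid_fg (Submonoid.powers h) _
  have : Algebra.FiniteType K (Localization.Away h) := Algebra.FiniteType.trans ‹_› this
  have : FaithfulSMul A (Localization.Away h) :=
    (faithfulSMul_iff_algebraMap_injective _ _).2 (IsLocalization.injective _ hle)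
  have : Algebra.IsAlgebraic A (Localization.Away h) :=
    IsLocalization.isAlgebraic _ (Submonoid.powers h)
  obtain ⟨s, x, hx, -⟩ := exists_isTranscendenceBasis_and_ringKrullDim_eq K A
  rw [ringKrullDim_eq_of_isTranscendenceBasis hx,
    ringKrullDim_eq_of_isTranscendenceBasis (hx.algebraMap_comp (A := Localization.Away h))]

section Coordinates

variable {K σ : Type*} [Field K] (P : Ideal (MvPolynomial σ K)) [P.IsPrime]

theorem exists_isTranscendenceBasis_X :
    ∃ t : Set σ, IsTranscendenceBasis K fun i : t => Ideal.Quotient.mk P (X i.1) := by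
  let x (i : σ) : MvPolynomial σ K ⧸ P := Ideal.Quotient.mk P (X i)
  have hadj : Algebra.adjoin K (Set.range x) = ⊤ := by
    have h := congrArg (Subalgebra.map (Ideal.Quotient.mkₐ K P)) (adjoin_range_X (R := K) (σ := σ))
    rwa [AlgHom.map_adjoin, ← Set.range_comp, Algebra.map_top,
      (AlgHom.range_eq_top _).2 (Ideal.Quotient.mkₐ_surjective K P)] at h
  have : Algebra.IsAlgebraic (Algebra.adjoin K (Set.range x)) (MvPolynomial σ K ⧸ P) := by
    rw [hadj]
    have := Algebra.isIntegral_of_surjective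
      (R := (⊤ : Subalgebra K (MvPolynomial σ K ⧸ P))) (B := MvPolynomial σ K ⧸ P)
      fun a => ⟨⟨a, trivial⟩, rfl⟩
    exact Algebra.IsIntegral.isAlgebraic
  have : FaithfulSMul K (MvPolynomial σ K ⧸ P) :=
    (faithfulSMul_iff_algebraMap_injective K (MvPolynomial σ K ⧸ P)).2 (algebraMap K _).injective
  obtain ⟨u, hu, hb⟩ := exists_isTranscendenceBasis_subset (R := K) (Set.range x)
  choose f hf using fun a : u => hu a.2
  have hinj : Function.Injective f := fun a b h => Subtype.ext (by rw [← hf a, ← hf b, h])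
  refine ⟨Set.range f, (isTranscendenceBasis_equiv' (Equiv.ofInjective f hinj) ?_).1 hb⟩
  ext a
  exact hf a

theorem exists_algebraicIndependent_X [Finite σ] {d : ℕ}
    (hd : (d : WithBot ℕ∞) ≤ ringKrullDim (MvPolynomial σ K ⧸ P)) :
    ∃ x : Fin d → σ, AlgebraicIndependent K fun a => Ideal.Quotient.mk P (X (x a)) := by
  obtain ⟨t, ht⟩ := exists_isTranscendenceBasis_X P
  rw [ringKrullDim_eq_of_isTranscendenceBasis ht] at hd
  let e : Fin d ↪ t := (Fin.castLEEmb (by exact_mod_cast hd)).trans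
    (Finite.equivFin t).symm.toEmbedding
  exact ⟨fun a => (e a).1, ht.1.comp e e.injective⟩

end Coordinates

theorem exists_sub_algebraMap_mem {K R : Type*} [Field K] [IsAlgClosed K] [CommRing R]
    [Algebra K R] [Algebra.FiniteType K R] (m : Ideal R) [m.IsMaximal] (r : R) :
    ∃ c : K, r - algebraMap K R c ∈ m := by
  let : Field (R ⧸ m) := Ideal.Quotient.field m
  have : Algebra.FiniteType K (R ⧸ m) :=
    Algebra.FiniteType.of_surjective (Ideal.Quotient.mkₐ K m) (Ideal.Quotient.mkₐ_surjective K m)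
  have : Module.Finite K (R ⧸ m) := finite_of_finite_type_of_isJacobsonRing K (R ⧸ m)
  obtain ⟨c, hc⟩ := (IsAlgClosed.algebraMap_bijective_of_isIntegral (k := K) (K := R ⧸ m)).2
    (Ideal.Quotient.mk m r)
  exact ⟨c, Ideal.Quotient.eq.1 hc.symm⟩

-- `c` is the value of `r` at a maximal ideal of large height, where Krull's height theorem bounds
-- the drop of the dimension by one.
theorem exists_le_ringKrullDim_quotient_span_sub {K R : Type*} [Field K] [IsAlgClosed K]
    [CommRing R] [Algebra K R] [Algebra.FiniteType K R] (r : R) {d : ℕ}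
    (hd : ((d + 1 : ℕ) : WithBot ℕ∞) ≤ ringKrullDim R) :
    ∃ c : K, (d : WithBot ℕ∞) ≤ ringKrullDim (R ⧸ Ideal.span {r - algebraMap K R c}) := by
  have : IsNoetherianRing R := Algebra.FiniteType.isNoetherianRing K R
  obtain ⟨m, hm, hdm⟩ : ∃ m : Ideal R, m.IsMaximal ∧ ((d + 1 : ℕ) : WithBot ℕ∞) ≤ m.height := by
    by_contra! hcon
    have hdR : ringKrullDim R ≤ d :=
      (ringKrullDim_le_iff_isMaximal_height_le (R := R) d).2 fun m hm => by
        simpa [ENat.WithBot.lt_add_one_iff] using hcon m hm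
    exact absurd (hd.trans hdR) (by exact_mod_cast Nat.not_succ_le_self d)
  obtain ⟨c, hc⟩ := exists_sub_algebraMap_mem (K := K) m r
  refine ⟨c, le_of_not_gt fun hlt => ?_⟩
  have := hdm.trans ((Ideal.height_le_ringKrullDim_quotient_add_one hc).trans
    (ENat.WithBot.add_one_le_natCast_iff.2 hlt))
  exact absurd this (by exact_mod_cast Nat.not_succ_le_self d)

theorem exists_ltSeries_comap_of_injective {A B : Type*} [CommRing A] [CommRing B] {f : A →+* B}
    (hf : Function.Injective (PrimeSpectrum.comap f)) {d : ℕ}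
    (hd : (d : WithBot ℕ∞) ≤ ringKrullDim B) :
    ∃ l : LTSeries (PrimeSpectrum A), l.length = d ∧
      ∀ i, ∃ q : PrimeSpectrum B, l i = PrimeSpectrum.comap f q := by
  obtain ⟨l, hl⟩ := Order.le_krullDim_iff.1 hd
  have hmono : StrictMono (PrimeSpectrum.comap f) :=
    Monotone.strictMono_of_injective (fun p q hpq => Ideal.comap_mono hpq) hf
  exact ⟨l.map _ hmono, hl, fun i => ⟨l i, rfl⟩⟩

theorem exists_ltSeries_hyperplane {K σ : Type*} [Field K] [IsAlgClosed K] [Finite σ]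
    (P : Ideal (MvPolynomial σ K)) [P.IsPrime] {h : MvPolynomial σ K} (hh : h ∉ P) (j : σ) {d : ℕ}
    (hd : ((d + 1 : ℕ) : WithBot ℕ∞) ≤ ringKrullDim (MvPolynomial σ K ⧸ P)) :
    ∃ (c : K) (l : LTSeries (PrimeSpectrum (MvPolynomial σ K))), l.length = d ∧
      ∀ i, P ≤ (l i).asIdeal ∧ h ∉ (l i).asIdeal ∧ X j - C c ∈ (l i).asIdeal := by
  let A := MvPolynomial σ K ⧸ P
  let h' : A := Ideal.Quotient.mk P h
  have hh' : h' ≠ 0 := mt Ideal.Quotient.eq_zero_iff_mem.1 hh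
  let R := Localization.Away h'
  have : Algebra.FiniteType A R := IsLocalization.finiteType_of_monoid_fg (Submonoid.powers h') _
  have : Algebra.FiniteType K R := Algebra.FiniteType.trans inferInstance this
  let f : MvPolynomial σ K →+* R := (algebraMap A R).comp (Ideal.Quotient.mk P)
  rw [← ringKrullDim_localizationAway K hh'] at hd
  obtain ⟨c, hc⟩ := exists_le_ringKrullDim_quotient_span_sub (K := K) (f (X j)) hd
  let g := (Ideal.Quotient.mk (Ideal.span {f (X j) - algebraMap K R c})).comp f
  have hg : Function.Injective (PrimeSpectrum.comap g) := by
    rw [PrimeSpectrum.comap_comp, PrimeSpectrum.comap_comp]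
    exact ((PrimeSpectrum.comap_injective_of_surjective _ Ideal.Quotient.mk_surjective).comp
      (PrimeSpectrum.localization_comap_injective R (Submonoid.powers h'))).comp
      (PrimeSpectrum.comap_injective_of_surjective _ Ideal.Quotient.mk_surjective)
  obtain ⟨l, hl, hlq⟩ := exists_ltSeries_comap_of_injective hg hc
  refine ⟨c, l, hl, fun i => ?_⟩
  obtain ⟨q, hq⟩ := hlq i
  have hmem (p) : p ∈ (l i).asIdeal ↔ g p ∈ q.asIdeal := by rw [hq]; rfl
  refine ⟨fun p hp => ?_, fun hhl => ?_, ?_⟩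
  · simp [hmem, g, f, Ideal.Quotient.eq_zero_iff_mem.2 hp]
  · have hu : IsUnit (f h) := IsLocalization.Away.algebraMap_isUnit (S := R) h'
    have hgu : IsUnit (g h) := hu.map (Ideal.Quotient.mk _)
    exact q.2.ne_top (Ideal.eq_top_of_isUnit_mem _ ((hmem h).1 hhl) hgu)
  · have hX : f (X j - C c) = f (X j) - algebraMap K R c := by
      rw [map_sub, IsScalarTower.algebraMap_apply K A R]
      rfl
    simp [hmem, g, hX, -map_sub]

/-! ### The Zariski topology -/

section Zariski

variable {K ι E Q : Type*} [Field K]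

theorem mem_vanishingIdeal_iff_eval {S : Set (ι → K)} {p : MvPolynomial ι K} :
    p ∈ vanishingIdeal K S ↔ ∀ v ∈ S, eval v p = 0 := by
  simp [mem_vanishingIdeal_iff]

theorem eval_aeval {τ : Type*} (t : τ → K) (f : ι → MvPolynomial τ K) (p : MvPolynomial ι K) :
    eval t (aeval f p) = eval (fun i => eval t (f i)) p :=
  DFunLike.congr_fun (comp_aeval f (aeval t : MvPolynomial τ K →ₐ[K] K)) p

theorem isClosed_zariski_iff {Z : Set (ι → K)} :
    @IsClosed _ (zariski K ι) Z ↔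
      ∃ S : Set (MvPolynomial ι K), Z = {v | ∀ p ∈ S, eval v p = 0} := by
  let := zariski K ι
  rw [← isOpen_compl_iff]
  change Zᶜᶜ ∈ _ ↔ _
  rw [compl_compl]
  rfl

theorem isClosed_induced_zariski_iff {g : E → ι → K} {Z : Set E} :
    @IsClosed _ (.induced g (zariski K ι)) Z ↔
      ∃ S : Set (MvPolynomial ι K), ∀ e, e ∈ Z ↔ ∀ p ∈ S, eval (g e) p = 0 := by
  let := zariski K ι
  let := TopologicalSpace.induced g (zariski K ι)
  rw [isClosed_induced_iff]
  constructor
  · rintro ⟨t, ht, rfl⟩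
    obtain ⟨S, rfl⟩ := isClosed_zariski_iff.1 ht
    exact ⟨S, fun e => Iff.rfl⟩
  · rintro ⟨S, hS⟩
    exact ⟨_, isClosed_zariski_iff.2 ⟨S, rfl⟩, Set.ext fun e => (hS e).symm⟩

theorem isClosed_coinduced_zariski_iff {f : E → Q} {g : E → ι → K} {Z : Set Q} :
    @IsClosed _ (.coinduced f (.induced g (zariski K ι))) Z ↔
      ∃ S : Set (MvPolynomial ι K), ∀ e, f e ∈ Z ↔ ∀ p ∈ S, eval (g e) p = 0 := by
  rw [isClosed_coinduced, isClosed_induced_zariski_iff]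
  rfl

theorem zeroLocus_vanishingIdeal_of_isClosed {Z : Set (ι → K)}
    (hZ : @IsClosed _ (zariski K ι) Z) : zeroLocus K (vanishingIdeal K Z) = Z := by
  obtain ⟨S, rfl⟩ := isClosed_zariski_iff.1 hZ
  refine Set.Subset.antisymm (fun v hv p hp => ?_) fun v hv => ?_
  · simpa using hv p (mem_vanishingIdeal_iff_eval.2 fun w hw => hw p hp)
  · exact fun p hp => hp v hv

variable (K ι) in
theorem noetherianSpace_zariski [Finite ι] :
    @TopologicalSpace.NoetherianSpace (ι → K) (zariski K ι) := by
  let := zariski K ι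
  refine ((TopologicalSpace.noetherianSpace_TFAE (ι → K)).out 0 1).2 ?_
  have hanti : StrictAnti fun Z : TopologicalSpace.Closeds (ι → K) =>
      vanishingIdeal K (Z : Set (ι → K)) := by
    refine Antitone.strictAnti_of_injective (fun Z Z' h => vanishingIdeal_anti_mono h)
      fun Z Z' h => SetLike.coe_injective ?_
    exact (zeroLocus_vanishingIdeal_of_isClosed Z.2).symm.trans
      ((congrArg (zeroLocus K) h).trans (zeroLocus_vanishingIdeal_of_isClosed Z'.2))
  exact ⟨hanti.wellFoundedLT.wf⟩

end Zariski

/-! ### Quotients by tori -/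

/-- The topological space `Q` is the quotient of the set `E`, embedded in the affine space `K^ι`
by `g`, by the torus `(Kˣ)^τ`, whose factor `r i` scales the `i`-th coordinate. This treats
projective space and products of two projective spaces at the same time. -/
structure IsTorusQuotient {K ι τ E Q : Type*} [Field K] [t : TopologicalSpace Q] (r : ι → τ)
    (f : E → Q) (g : E → ι → K) : Prop where
  topology_eq : t = .coinduced f (.induced g (zariski K ι))
  surjective : Function.Surjective f
  exists_eq_mul : ∀ e, ∀ t : τ → K, (∀ a, t a ≠ 0) → ∃ e', g e' = fun i => t (r i) * g e i
  eq_iff : ∀ e e', f e' = f e ↔ ∃ t : τ → K, (∀ a, t a ≠ 0) ∧ g e' = fun i => t (r i) * g e i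

section Orbit

variable {K ι τ : Type*} [Field K] (r : ι → τ)

/-- The pullback of polynomial functions on `K^ι` to the torus `(Kˣ)^τ`, along the orbit of `v`. -/
def orbitPullback (v : ι → K) : MvPolynomial ι K →ₐ[K] MvPolynomial τ K :=
  aeval fun i => X (r i) * C (v i)

theorem eval_orbitPullback (v : ι → K) (p : MvPolynomial ι K) (t : τ → K) :
    eval t (orbitPullback r v p) = eval (fun i => t (r i) * v i) p := by
  rw [orbitPullback, eval_aeval]
  simp

theorem eq_zero_of_forall_eval_eq_zero_of_ne_zero [Infinite K] {p h : MvPolynomial τ K}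
    (hh : h ≠ 0) (hp : ∀ t, eval t h ≠ 0 → eval t p = 0) : p = 0 := by
  have hhp : h * p = 0 := MvPolynomial.funext fun t => by
    by_cases ht : eval t h = 0
    · simp [ht]
    · simp [hp t ht]
  exact (mul_eq_zero.1 hhp).resolve_left hh

theorem orbitPullback_eq_zero [Infinite K] [Finite τ] {v : ι → K} {p : MvPolynomial ι K}
    (hp : ∀ t : τ → K, (∀ a, t a ≠ 0) → eval (fun i => t (r i) * v i) p = 0) :
    orbitPullback r v p = 0 := by
  have := Fintype.ofFinite τ
  refine eq_zero_of_forall_eval_eq_zero_of_ne_zero (h := ∏ a : τ, X a)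
    (Finset.prod_ne_zero_iff.2 fun a _ => X_ne_zero a) fun t ht => ?_
  rw [eval_orbitPullback]
  exact hp t (by simpa [Finset.prod_eq_zero_iff] using ht)

end Orbit

namespace IsTorusQuotient

variable {K ι τ E Q : Type*} [Field K] [TopologicalSpace Q] {r : ι → τ} {f : E → Q}
  {g : E → ι → K}

theorem noetherianSpace [Finite ι] (hf : IsTorusQuotient r f g) :
    TopologicalSpace.NoetherianSpace Q := by
  let := zariski K ι
  let := TopologicalSpace.induced g (zariski K ι)
  have := noetherianSpace_zariski K ι
  have : TopologicalSpace.NoetherianSpace E :=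
    Topology.IsInducing.noetherianSpace (i := g) ⟨rfl⟩
  exact TopologicalSpace.noetherianSpace_of_surjective f
    (continuous_iff_coinduced_le.2 hf.topology_eq.ge) hf.surjective

theorem forall_eval_eq_zero_iff (hf : IsTorusQuotient r f g) (p : MvPolynomial ι K) (e : E) :
    (∀ e', f e' = f e → eval (g e') p = 0) ↔
      ∀ t : τ → K, (∀ a, t a ≠ 0) → eval (fun i => t (r i) * g e i) p = 0 := by
  constructor
  · intro h t ht
    obtain ⟨e', he'⟩ := hf.exists_eq_mul e t ht
    exact he' ▸ h e' ((hf.eq_iff e e').2 ⟨t, ht, he'⟩)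
  · intro h e' he'
    obtain ⟨t, ht, hte⟩ := (hf.eq_iff e e').1 he'
    exact hte ▸ h t ht

theorem isClosed_setOf_forall_eval_eq_zero (hf : IsTorusQuotient r f g) (p : MvPolynomial ι K) :
    IsClosed {x | ∀ e, f e = x → eval (g e) p = 0} := by
  rw [hf.topology_eq, isClosed_coinduced_zariski_iff]
  refine ⟨{q | ∃ t : τ → K, (∀ a, t a ≠ 0) ∧ q = aeval (fun i => C (t (r i)) * X i) p},
    fun e => ?_⟩
  have heval (t : τ → K) : eval (g e) (aeval (fun i => C (t (r i)) * X i) p) =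
      eval (fun i => t (r i) * g e i) p := by
    rw [eval_aeval]
    simp
  rw [Set.mem_ofPred_eq, hf.forall_eval_eq_zero_iff]
  constructor
  · rintro h q ⟨t, ht, rfl⟩
    rw [heval]
    exact h t ht
  · intro h t ht
    rw [← heval]
    exact h _ ⟨t, ht, rfl⟩

theorem forall_eval_eq_zero_or_of_mul [Infinite K] [Finite τ] (hf : IsTorusQuotient r f g)
    {p q : MvPolynomial ι K} {x : Q} (hpq : ∀ e, f e = x → eval (g e) (p * q) = 0) :
    (∀ e, f e = x → eval (g e) p = 0) ∨ ∀ e, f e = x → eval (g e) q = 0 := by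
  obtain ⟨e, rfl⟩ := hf.surjective x
  simp only [hf.forall_eval_eq_zero_iff] at hpq ⊢
  have hφ := orbitPullback_eq_zero r hpq
  rw [map_mul, mul_eq_zero] at hφ
  refine hφ.imp (fun h t _ => ?_) fun h t _ => ?_ <;> rw [← eval_orbitPullback, h, map_zero]

theorem isPrime_vanishingIdeal [Infinite K] [Finite τ] (hf : IsTorusQuotient r f g) {W : Set Q}
    (hW : IsIrreducible W) : (vanishingIdeal K (g '' (f ⁻¹' W))).IsPrime := by
  let Z (p : MvPolynomial ι K) : Set Q := {x | ∀ e, f e = x → eval (g e) p = 0}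
  have hmem (p) : p ∈ vanishingIdeal K (g '' (f ⁻¹' W)) ↔ W ⊆ Z p := by
    rw [mem_vanishingIdeal_iff_eval, Set.forall_mem_image]
    exact ⟨fun h x hx e he => h (by rwa [Set.mem_preimage, he]), fun h e he => h he e rfl⟩
  refine ⟨?_, fun {p q} hpq => ?_⟩
  · obtain ⟨w, hw⟩ := hW.nonempty
    obtain ⟨e, rfl⟩ := hf.surjective w
    rw [Ideal.ne_top_iff_one, mem_vanishingIdeal_iff_eval]
    exact fun h => by simpa using h (g e) ⟨e, hw, rfl⟩
  · rw [hmem] at hpq ⊢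
    rw [hmem]
    exact isPreirreducible_iff_isClosed_union_isClosed.1 hW.isPreirreducible _ _
      (hf.isClosed_setOf_forall_eval_eq_zero p) (hf.isClosed_setOf_forall_eval_eq_zero q)
      fun x hx => hf.forall_eval_eq_zero_or_of_mul (hpq hx)

end IsTorusQuotient

/-! ### Cones over projective sets -/

section Cones

variable {K : Type*} [Field K] {M N : ℕ}

theorem mk_eq_mk_iff_exists_ne_zero {V : Type*} [AddCommGroup V] [Module K V]
    {v w : V} (hv : v ≠ 0) (hw : w ≠ 0) :
    Projectivization.mk K v hv = Projectivization.mk K w hw ↔ ∃ a : K, a ≠ 0 ∧ v = a • w := by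
  rw [Projectivization.mk_eq_mk_iff']
  refine exists_congr fun a => ⟨?_, fun h => h.2.symm⟩
  rintro rfl
  exact ⟨left_ne_zero_of_smul hv, rfl⟩

variable (K N) in
theorem ProjSpace.isTorusQuotient :
    IsTorusQuotient (fun _ : Fin (N + 1) => ())
      (fun v : {v : Fin (N + 1) → K // v ≠ 0} => Projectivization.mk K v.1 v.2) Subtype.val where
  topology_eq := rfl
  surjective x := ⟨⟨x.rep, x.rep_nonzero⟩, x.mk_rep⟩
  exists_eq_mul v t ht := ⟨⟨t () • v.1, smul_ne_zero (ht ()) v.2⟩, rfl⟩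
  eq_iff v v' := by
    rw [mk_eq_mk_iff_exists_ne_zero v'.2 v.2]
    exact ⟨fun ⟨a, ha, h⟩ => ⟨fun _ => a, fun _ => ha, h⟩, fun ⟨t, ht, h⟩ => ⟨t (), ht (), h⟩⟩

variable (K M N) in
theorem BiProjSpace.isTorusQuotient :
    IsTorusQuotient (Q := BiProjSpace K M N)
      (Sum.elim (fun _ : Fin (M + 1) => true) fun _ : Fin (N + 1) => false)
      (fun z : {z : (Fin (M + 1) → K) × (Fin (N + 1) → K) // z.1 ≠ 0 ∧ z.2 ≠ 0} =>
        (Projectivization.mk K z.1.1 z.2.1, Projectivization.mk K z.1.2 z.2.2))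
      fun z => Sum.elim z.1.1 z.1.2 where
  topology_eq := rfl
  surjective := fun ⟨x, y⟩ =>
    ⟨⟨(x.rep, y.rep), x.rep_nonzero, y.rep_nonzero⟩, Prod.ext x.mk_rep y.mk_rep⟩
  exists_eq_mul := by
    rintro ⟨⟨u, v⟩, hu, hv⟩ t ht
    refine ⟨⟨(t true • u, t false • v), smul_ne_zero (ht _) hu, smul_ne_zero (ht _) hv⟩, ?_⟩
    ext (i | i) <;> simp
  eq_iff := by
    rintro ⟨⟨u, v⟩, hu, hv⟩ ⟨⟨u', v'⟩, hu', hv'⟩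
    refine (Prod.ext_iff.trans (and_congr (mk_eq_mk_iff_exists_ne_zero hu' hu)
      (mk_eq_mk_iff_exists_ne_zero hv' hv))).trans ?_
    constructor
    · rintro ⟨⟨a, ha, rfl⟩, b, hb, rfl⟩
      refine ⟨fun c => if c then a else b, fun c => by cases c <;> simpa, ?_⟩
      ext (i | i) <;> simp
    · rintro ⟨t, ht, h⟩
      refine ⟨⟨t true, ht _, ?_⟩, t false, ht _, ?_⟩ <;> ext i
      · simpa using congrFun h (Sum.inl i)
      · simpa using congrFun h (Sum.inr i)

instance BiProjSpace.instNoetherianSpace (K : Type*) [Field K] (M N : ℕ) :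
    TopologicalSpace.NoetherianSpace (BiProjSpace K M N) :=
  (BiProjSpace.isTorusQuotient K M N).noetherianSpace

theorem isPrime_vanishingIdeal_cone [Infinite K] {Z : Set (ProjSpace K N)}
    (hZ : IsIrreducible Z) : (vanishingIdeal K (cone Z)).IsPrime := by
  convert (ProjSpace.isTorusQuotient K N).isPrime_vanishingIdeal hZ
  ext v
  exact ⟨fun ⟨h, hv⟩ => ⟨⟨v, h⟩, hv, rfl⟩, by rintro ⟨⟨v, h⟩, hv, rfl⟩; exact ⟨h, hv⟩⟩

theorem isPrime_vanishingIdeal_bicone [Infinite K] {Z : Set (BiProjSpace K M N)}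
    (hZ : IsIrreducible Z) : (vanishingIdeal K (bicone Z)).IsPrime := by
  convert (BiProjSpace.isTorusQuotient K M N).isPrime_vanishingIdeal hZ
  ext z
  constructor
  · rintro ⟨u, v, hu, hv, rfl, h⟩
    exact ⟨⟨(u, v), hu, hv⟩, h, rfl⟩
  · rintro ⟨⟨⟨u, v⟩, hu, hv⟩, h, rfl⟩
    exact ⟨u, v, hu, hv, rfl, h⟩

theorem isClosed_projSpace_iff {Z : Set (ProjSpace K N)} :
    IsClosed Z ↔ ∃ S : Set (MvPolynomial (Fin (N + 1)) K), ∀ (v : Fin (N + 1) → K) (hv : v ≠ 0),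
      Projectivization.mk K v hv ∈ Z ↔ ∀ p ∈ S, eval v p = 0 :=
  isClosed_coinduced_zariski_iff.trans
    ⟨fun ⟨S, hS⟩ => ⟨S, fun v hv => hS ⟨v, hv⟩⟩, fun ⟨S, hS⟩ => ⟨S, fun v => hS v.1 v.2⟩⟩

theorem smul_mem_cone {Z : Set (ProjSpace K N)} {v : Fin (N + 1) → K} (hv : v ∈ cone Z) {t : K}
    (ht : t ≠ 0) : t • v ∈ cone Z := by
  obtain ⟨h, hv⟩ := hv
  refine ⟨smul_ne_zero ht h, ?_⟩
  rwa [(mk_eq_mk_iff_exists_ne_zero (smul_ne_zero ht h) h).2 ⟨t, ht, rfl⟩]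

theorem rep_mem_cone {Z : Set (ProjSpace K N)} {x : ProjSpace K N} (hx : x ∈ Z) :
    x.rep ∈ cone Z :=
  ⟨x.rep_nonzero, by rwa [x.mk_rep]⟩

theorem vanishingIdeal_cone_le_iff {Y Z : Set (ProjSpace K N)} :
    vanishingIdeal K (cone Z) ≤ vanishingIdeal K (cone Y) ↔ Y ⊆ closure Z := by
  constructor
  · intro h y hy
    obtain ⟨S, hS⟩ := isClosed_projSpace_iff.1 (isClosed_closure (s := Z))
    rw [← y.mk_rep, hS]
    intro p hp
    have hpZ : p ∈ vanishingIdeal K (cone Z) :=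
      mem_vanishingIdeal_iff_eval.2 fun v ⟨hv, hvZ⟩ => (hS v hv).1 (subset_closure hvZ) p hp
    exact mem_vanishingIdeal_iff_eval.1 (h hpZ) _ (rep_mem_cone hy)
  · intro h p hp
    have hZ : Z ⊆ {x | ∀ v : {v : Fin (N + 1) → K // v ≠ 0},
        Projectivization.mk K v.1 v.2 = x → eval v.1 p = 0} := by
      rintro _ hx v rfl
      exact mem_vanishingIdeal_iff_eval.1 hp _ ⟨v.2, hx⟩
    have hY := h.trans <|
      closure_minimal hZ ((ProjSpace.isTorusQuotient K N).isClosed_setOf_forall_eval_eq_zero p)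
    exact mem_vanishingIdeal_iff_eval.2 fun v ⟨hv, hvY⟩ => hY hvY ⟨v, hv⟩ rfl

theorem vanishingIdeal_cone_lt_vanishingIdeal_zero [Infinite K] {Z : Set (ProjSpace K N)}
    (hZ : Z.Nonempty) : vanishingIdeal K (cone Z) < vanishingIdeal K {(0 : Fin (N + 1) → K)} := by
  obtain ⟨z, hz⟩ := hZ
  refine SetLike.lt_iff_le_and_exists.2 ⟨fun p hp => ?_, ?_⟩
  · have h := orbitPullback_eq_zero (fun _ : Fin (N + 1) => ()) fun t ht =>
      mem_vanishingIdeal_iff_eval.1 hp _ (smul_mem_cone (rep_mem_cone hz) (ht ()))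
    have h0 := congrArg (eval 0) h
    rw [eval_orbitPullback, map_zero] at h0
    rw [mem_vanishingIdeal_iff_eval]
    rintro _ rfl
    simpa using h0
  · obtain ⟨i, hi⟩ := Function.ne_iff.1 z.rep_nonzero
    refine ⟨X i, by simp, fun h => hi ?_⟩
    simpa using mem_vanishingIdeal_iff_eval.1 h _ (rep_mem_cone hz)

theorem vanishingIdeal_cone_image_lt {Z : Set (ProjSpace K N)}
    {Y Y' : TopologicalSpace.IrreducibleCloseds Z} (h : Y < Y') :
    vanishingIdeal K (cone (Subtype.val '' (Y' : Set Z))) <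
      vanishingIdeal K (cone (Subtype.val '' (Y : Set Z))) := by
  refine lt_of_le_not_ge ?_ fun hle => h.not_ge fun y hy => ?_
  · exact vanishingIdeal_cone_le_iff.2
      ((Set.image_mono (SetLike.coe_subset_coe.2 h.le)).trans subset_closure)
  · have hcl : y ∈ closure (Y : Set Z) := by
      rw [Topology.IsInducing.subtypeVal.closure_eq_preimage_closure_image]
      exact vanishingIdeal_cone_le_iff.1 hle ⟨y, hy, rfl⟩
    rwa [Y.isClosed.closure_eq] at hcl

theorem topologicalKrullDim_add_one_le [Infinite K] {Z : Set (ProjSpace K N)}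
    (hZ : Z.Nonempty) :
    topologicalKrullDim Z + 1 ≤
      ringKrullDim (MvPolynomial (Fin (N + 1)) K ⧸ vanishingIdeal K (cone Z)) := by
  have hirr (Y : TopologicalSpace.IrreducibleCloseds Z) :
      IsIrreducible (Subtype.val '' (Y : Set Z)) :=
    Y.isIrreducible.image _ continuous_subtype_val.continuousOn
  have hle (Y : TopologicalSpace.IrreducibleCloseds Z) :
      vanishingIdeal K (cone Z) ≤ vanishingIdeal K (cone (Subtype.val '' (Y : Set Z))) :=
    vanishingIdeal_cone_le_iff.2 ((Subtype.coe_image_subset _ _).trans subset_closure)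
  obtain ⟨z, hz⟩ := hZ
  have : Nonempty (TopologicalSpace.IrreducibleCloseds Z) :=
    ⟨⟨closure {⟨z, hz⟩}, isIrreducible_singleton.closure, isClosed_closure⟩⟩
  rw [topologicalKrullDim, ← Order.krullDim_withBot, ringKrullDim_quotient,
    ← Order.krullDim_orderDual (α := PrimeSpectrum.zeroLocus _)]
  let F : WithBot (TopologicalSpace.IrreducibleCloseds Z) →
      (PrimeSpectrum.zeroLocus
        (vanishingIdeal K (cone Z) : Set (MvPolynomial (Fin (N + 1)) K)))ᵒᵈ :=
    WithBot.recBotCoe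
      -- The cone adds one step to a chain: the origin, whose ideal contains all the others.
      (OrderDual.toDual ⟨⟨vanishingIdeal K {0}, inferInstance⟩,
        (vanishingIdeal_cone_lt_vanishingIdeal_zero ⟨z, hz⟩).le⟩)
      fun Y => OrderDual.toDual ⟨⟨_, isPrime_vanishingIdeal_cone (hirr Y)⟩, hle Y⟩
  refine Order.krullDim_le_of_strictMono F fun Y Y' h => ?_
  induction Y' with
  | bot => exact absurd h not_lt_bot
  | coe Y' =>
    induction Y with
    | bot => exact vanishingIdeal_cone_lt_vanishingIdeal_zero (hirr Y').nonempty
    | coe Y => exact vanishingIdeal_cone_image_lt (WithBot.coe_lt_coe.1 h)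

end Cones

/-! ### Zariski tangent spaces -/

section TangentSpaces

variable {K ι τ : Type*} [Field K]

/-- The restriction of polynomial functions to the parametrized line `t ↦ z + t w`. Tangency of `w`
at `z` is the vanishing of its derivative at `0`, and this description behaves well under linear
maps. -/
def lineRestrict (z w : ι → K) : MvPolynomial ι K →ₐ[K] Polynomial K :=
  aeval fun i => Polynomial.C (z i) + Polynomial.C (w i) * Polynomial.X

theorem eval_lineRestrict (z w : ι → K) (t : K) (p : MvPolynomial ι K) :
    (lineRestrict z w p).eval t = eval (fun i => z i + w i * t) p := by
  change Polynomial.aeval t (lineRestrict z w p) = aeval (fun i => z i + w i * t) p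
  rw [lineRestrict, ← AlgHom.comp_apply, comp_aeval]
  simp

theorem eval_derivative_lineRestrict [Fintype ι] (z w : ι → K) (p : MvPolynomial ι K) :
    (Polynomial.derivative (lineRestrict z w p)).eval 0 = ∑ i, w i * eval z (pderiv i p) := by
  have h := derivation_aeval_eq_sum (Polynomial.derivative' (R := K))
    (fun i => Polynomial.C (z i) + Polynomial.C (w i) * Polynomial.X) p
  have heval (q : MvPolynomial ι K) : (lineRestrict z w q).eval 0 = eval z q := by
    simp [eval_lineRestrict]
  calc (Polynomial.derivative (lineRestrict z w p)).eval 0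
      = ∑ i, (lineRestrict z w (pderiv i p)).eval 0 * w i := by
        have h' := congrArg (Polynomial.eval 0) h
        simpa [lineRestrict, Polynomial.eval_finsetSum] using h'
    _ = ∑ i, w i * eval z (pderiv i p) := by simp only [heval, mul_comm]

theorem mem_zariskiTangent_iff [Fintype ι] {S : Set (ι → K)} {z w : ι → K} :
    w ∈ zariskiTangent S z ↔ ∀ p ∈ vanishingIdeal K S,
      (Polynomial.derivative (lineRestrict z w p)).eval 0 = 0 := by
  simp_rw [eval_derivative_lineRestrict, mem_vanishingIdeal_iff_eval]
  rfl

theorem zariskiTangent_mono [Fintype ι] {S S' : Set (ι → K)} (h : S ⊆ S') (z : ι → K) :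
    zariskiTangent S z ≤ zariskiTangent S' z :=
  fun _ hw p hp => hw p fun c hc => hp c (h hc)

theorem map_mem_zariskiTangent [Fintype ι] [Fintype τ] (L : (ι → K) →ₗ[K] τ → K)
    {S : Set (ι → K)} {S' : Set (τ → K)} (hL : Set.MapsTo L S S') {z w : ι → K}
    (hw : w ∈ zariskiTangent S z) : L w ∈ zariskiTangent S' (L z) := by
  classical
  rw [mem_zariskiTangent_iff] at hw ⊢
  intro p hp
  let ℓ (j : τ) : MvPolynomial ι K := ∑ i, C (L.toMatrix' j i) * X i
  have hℓ (v : ι → K) (j : τ) : L v j = ∑ i, L.toMatrix' j i * v i :=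
    congrFun (L.toMatrix'_mulVec v).symm j
  have h : lineRestrict (L z) (L w) p = lineRestrict z w (aeval ℓ p) := by
    rw [lineRestrict, lineRestrict, ← AlgHom.comp_apply, comp_aeval]
    congr 2
    ext1 j
    rw [hℓ z, hℓ w]
    simp [ℓ, mul_add, Finset.sum_add_distrib, Finset.sum_mul, mul_assoc]
  rw [h]
  refine hw _ (mem_vanishingIdeal_iff_eval.2 fun v hv => ?_)
  have heval : (fun j => eval v (ℓ j)) = L v := by
    ext j
    simp only [ℓ, hℓ, map_sum, map_mul, eval_X, eval_C]
  rw [eval_aeval, heval]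
  exact mem_vanishingIdeal_iff_eval.1 hp _ (hL hv)

theorem mem_zariskiTangent_of_infinite [Fintype ι] {S : Set (ι → K)} {z w : ι → K}
    (h : {t : K | (fun i => z i + w i * t) ∈ S}.Infinite) : w ∈ zariskiTangent S z := by
  rw [mem_zariskiTangent_iff]
  intro p hp
  have h0 : lineRestrict z w p = 0 :=
    Polynomial.eq_zero_of_infinite_isRoot _ (h.mono fun t ht =>
      (eval_lineRestrict z w t p).trans (mem_vanishingIdeal_iff_eval.1 hp _ ht))
  simp [h0]

variable {M N : ℕ}

theorem mem_zariskiTangent_cone_smul {Z : Set (ProjSpace K N)} {z w : Fin (N + 1) → K} {t : K}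
    (ht : t ≠ 0) (hw : w ∈ zariskiTangent (cone Z) z) : w ∈ zariskiTangent (cone Z) (t • z) := by
  have h := map_mem_zariskiTangent (t • LinearMap.id) (fun z hz => smul_mem_cone hz ht) hw
  simpa [smul_smul, ht] using (zariskiTangent (cone Z) (t • z)).smul_mem t⁻¹ h

theorem elim_mem_bicone_iff {Z : Set (BiProjSpace K M N)} {u : Fin (M + 1) → K}
    {v : Fin (N + 1) → K} :
    Sum.elim u v ∈ bicone Z ↔ ∃ (hu : u ≠ 0) (hv : v ≠ 0),
      ((Projectivization.mk K u hu, Projectivization.mk K v hv) : BiProjSpace K M N) ∈ Z := by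
  constructor
  · rintro ⟨u', v', hu, hv, h, hZ⟩
    obtain ⟨rfl, rfl⟩ := Sum.elim_eq_iff.1 h
    exact ⟨hu, hv, hZ⟩
  · rintro ⟨hu, hv, h⟩
    exact ⟨u, v, hu, hv, rfl, h⟩

theorem smul_elim_smul_mem_bicone {Z : Set (BiProjSpace K M N)} {s t : K} (hs : s ≠ 0) (ht : t ≠ 0)
    {u : Fin (M + 1) → K} {v : Fin (N + 1) → K} (hz : Sum.elim u v ∈ bicone Z) :
    Sum.elim (s • u) (t • v) ∈ bicone Z := by
  obtain ⟨hu, hv, h⟩ := elim_mem_bicone_iff.1 hz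
  refine elim_mem_bicone_iff.2 ⟨smul_ne_zero hs hu, smul_ne_zero ht hv, ?_⟩
  rwa [(mk_eq_mk_iff_exists_ne_zero (smul_ne_zero hs hu) hu).2 ⟨s, hs, rfl⟩,
    (mk_eq_mk_iff_exists_ne_zero (smul_ne_zero ht hv) hv).2 ⟨t, ht, rfl⟩]

end TangentSpaces

/-! ### Local frames of a regular family of linear spaces -/

section Frames

theorem contains_mk_iff {K : Type*} [Field K] {N k : ℕ} {L : Grass K N k} {v : Fin (N + 1) → K}
    (hv : v ≠ 0) : L.Contains (Projectivization.mk K v hv) ↔ v ∈ L.1 := by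
  rw [Grass.Contains, Projectivization.submodule_mk, Submodule.span_singleton_le_iff_mem]

variable {K m n σ : Type*} [Field K] [Fintype n]

theorem exists_mul_eq_one_of_linearIndependent_row [Finite m] [DecidableEq m] {A : Matrix m n K}
    (hA : LinearIndependent K A.row) : ∃ c : Matrix n m K, A * c = 1 := by
  have := Fintype.ofFinite m
  have hr : finrank K (LinearMap.range A.mulVecLin) = finrank K (m → K) := by
    rw [finrank_fintype_fun_eq_card, ← hA.rank_matrix, Matrix.rank]
  exact Matrix.mulVec_surjective_iff_exists_right_inverse.1
    (LinearMap.range_eq_top.1 (Submodule.eq_top_of_finrank_eq hr))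

theorem linearIndependent_row_of_det_mul_ne_zero [Fintype m] [DecidableEq m] {A : Matrix m n K}
    {c : Matrix n m K}
    (h : (A * c).det ≠ 0) : LinearIndependent K A.row := by
  rw [← Matrix.vecMul_injective_iff]
  have hinj : Function.Injective fun a : m → K => (a ᵥ* A) ᵥ* c := by
    simpa only [Matrix.vecMul_vecMul] using Matrix.vecMul_injective_iff.2
      (Matrix.linearIndependent_rows_iff_isUnit.2
        ((Matrix.isUnit_iff_isUnit_det _).2 h.isUnit))
  exact Function.Injective.of_comp (f := fun v => v ᵥ* c) hinj

theorem mem_span_range_row_iff_vecMul_eq_zero [Fintype m] [DecidableEq m] [DecidableEq n]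
    {A : Matrix m n K} {c : Matrix n m K} (h : (A * c).det ≠ 0) {v : n → K} :
    v ∈ Submodule.span K (Set.range A.row) ↔
      v ᵥ* ((A * c).det • (1 : Matrix n n K) - c * (A * c).adjugate * A) = 0 := by
  rw [Matrix.vecMul_sub, Matrix.vecMul_smul, Matrix.vecMul_one, sub_eq_zero, ← range_vecMulLinear]
  constructor
  · rintro ⟨a, rfl⟩
    rw [Matrix.vecMulLinear_apply, Matrix.vecMul_vecMul, ← Matrix.mul_assoc, ← Matrix.mul_assoc,
      Matrix.mul_adjugate, Matrix.smul_mul, Matrix.one_mul, Matrix.vecMul_smul]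
  · intro hv
    rw [← Submodule.smul_mem_iff _ h, hv]
    exact ⟨v ᵥ* (c * (A * c).adjugate), Matrix.vecMul_vecMul _ _ _⟩

theorem exists_equations_span_range_row [Finite m] {A : Matrix m n (MvPolynomial σ K)}
    {u₀ : σ → K} (hA : LinearIndependent K (A.map (eval u₀)).row) :
    ∃ (δ : MvPolynomial σ K) (E : Matrix n n (MvPolynomial σ K)), eval u₀ δ ≠ 0 ∧
      ∀ u, eval u δ ≠ 0 → LinearIndependent K (A.map (eval u)).row ∧
        ∀ v, v ∈ Submodule.span K (Set.range (A.map (eval u)).row) ↔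
          v ᵥ* E.map (eval u) = 0 := by
  classical
  have := Fintype.ofFinite m
  obtain ⟨c, hc⟩ := exists_mul_eq_one_of_linearIndependent_row hA
  let c' : Matrix n m (MvPolynomial σ K) := c.map C
  have hc' (u : σ → K) : c'.map (eval u) = c := by
    ext i j
    simp [c']
  have hmul (u : σ → K) : (A * c').map (eval u) = A.map (eval u) * c := by
    rw [Matrix.map_mul, hc']
  have hdet (u : σ → K) : eval u (A * c').det = (A.map (eval u) * c).det := by
    rw [← hmul, RingHom.map_det, RingHom.mapMatrix_apply]
  refine ⟨(A * c').det, (A * c').det • 1 - c' * (A * c').adjugate * A, ?_, fun u hu => ?_⟩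
  · rw [hdet, hc, Matrix.det_one]
    exact one_ne_zero
  have hE : ((A * c').det • 1 - c' * (A * c').adjugate * A).map (eval u) =
      (A.map (eval u) * c).det • 1 - c * (A.map (eval u) * c).adjugate * A.map (eval u) := by
    have hadj : (A * c').adjugate.map (eval u) = (A.map (eval u) * c).adjugate := by
      rw [← hmul]
      exact RingHom.map_adjugate (eval u) (A * c')
    rw [Matrix.map_sub _ (map_sub _), Matrix.map_mul, Matrix.map_mul, hc', hadj, ← hdet,
      Matrix.map_smul' _ _ _ (map_mul _), Matrix.map_one _ (map_zero _) (map_one _)]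
  rw [hdet] at hu
  refine ⟨linearIndependent_row_of_det_mul_ne_zero hu, fun v => ?_⟩
  rw [hE]
  exact mem_span_range_row_iff_vecMul_eq_zero hu

theorem eval_smul_of_isHomogeneous {p : MvPolynomial σ K} {d : ℕ} (hp : p.IsHomogeneous d) (a : K)
    (u : σ → K) : eval (a • u) p = a ^ d * eval u p := by
  rw [eval_eq, eval_eq, Finset.mul_sum]
  refine Finset.sum_congr rfl fun m hm => ?_
  have hd : ∑ i ∈ m.support, m i = d := by
    rw [← hp (mem_support_iff.1 hm), Finsupp.weight_apply, Finsupp.sum]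
    simp
  simp only [Pi.smul_apply, smul_eq_mul, mul_pow, Finset.prod_mul_distrib,
    Finset.prod_pow_eq_pow_sum, hd]
  ring

variable {M N k : ℕ} {Y : Set (ProjSpace K M)} {φ : Y → Grass K N k}

theorem IsRegularToGrass.exists_matrix (hφ : IsRegularToGrass φ) (y : Y) :
    ∃ A : Matrix (Fin (k + 1)) (Fin (N + 1)) (MvPolynomial (Fin (M + 1)) K),
      LinearIndependent K (A.map (eval y.1.rep)).row ∧
      ∀ (u : Fin (M + 1) → K) (hu : u ≠ 0) (hY : Projectivization.mk K u hu ∈ Y)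
        (hA : LinearIndependent K (A.map (eval u)).row),
        φ ⟨_, hY⟩ = Frame.span ⟨(A.map (eval u)).row, hA⟩ := by
  obtain ⟨d, A, hhom, hind, hspan⟩ := hφ y
  refine ⟨Matrix.of A, hind, fun u hu hY hA => ?_⟩
  set z : Y := ⟨_, hY⟩
  obtain ⟨a, ha, hau⟩ := (mk_eq_mk_iff_exists_ne_zero z.1.rep_nonzero hu).1 z.1.mk_rep
  have hunit : IsUnit (a ^ d) := (pow_ne_zero d ha).isUnit
  have hframe : (fun i j => eval z.1.rep (A i j)) =
      a ^ d • ((Matrix.of A).map (eval u)).row := by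
    ext i j
    rw [hau]
    exact eval_smul_of_isHomogeneous (hhom i j) a u
  have hz : LinearIndependent K fun i j => eval z.1.rep (A i j) := by
    rw [hframe]
    exact hA.units_smul fun _ => hunit.unit
  rw [hspan z hz]
  refine Subtype.ext ?_
  simp only [Frame.span, hframe]
  exact (congrArg _ (Set.smul_set_range ..).symm).trans
    (Submodule.span_smul_eq_of_isUnit _ _ hunit)

theorem IsRegularToGrass.exists_frame (hφ : IsRegularToGrass φ) (y : Y) :
    ∃ (A : Matrix (Fin (k + 1)) (Fin (N + 1)) (MvPolynomial (Fin (M + 1)) K))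
      (E : Matrix (Fin (N + 1)) (Fin (N + 1)) (MvPolynomial (Fin (M + 1)) K))
      (δ : MvPolynomial (Fin (M + 1)) K), eval y.1.rep δ ≠ 0 ∧
      ∀ (u : Fin (M + 1) → K) (hu : u ≠ 0) (hY : Projectivization.mk K u hu ∈ Y), eval u δ ≠ 0 →
        (∃ hA : LinearIndependent K (A.map (eval u)).row,
          φ ⟨_, hY⟩ = Frame.span ⟨(A.map (eval u)).row, hA⟩) ∧
        ∀ v, v ∈ (φ ⟨_, hY⟩).1 ↔ v ᵥ* E.map (eval u) = 0 := by
  obtain ⟨A, hAy, hspan⟩ := hφ.exists_matrix y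
  obtain ⟨δ, E, hδ, hE⟩ := exists_equations_span_range_row hAy
  refine ⟨A, E, δ, hδ, fun u hu hY hδu => ?_⟩
  obtain ⟨hA, hmem⟩ := hE u hδu
  exact ⟨⟨hA, hspan u hu hY hA⟩, fun v => by rw [hspan u hu hY hA]; exact hmem v⟩

end Frames

/-! ### The tangent spaces of the incidence correspondence -/

section IncidenceTangent

variable (K : Type*) [Field K] (M N : ℕ)

/-- The projection of the tangent space of `K^(M+1) × K^(N+1)` to that of the first factor. -/
def toBase : (Fin (M + 1) ⊕ Fin (N + 1) → K) →ₗ[K] (Fin (M + 1) → K) :=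
  LinearMap.funLeft K K Sum.inl

/-- The projection of the tangent space of `K^(M+1) × K^(N+1)` to that of the second factor. -/
def toSpace : (Fin (M + 1) ⊕ Fin (N + 1) → K) →ₗ[K] (Fin (N + 1) → K) :=
  LinearMap.funLeft K K Sum.inr

/-- The inclusion of the vertical vectors `(0, w)` in the tangent space of
`K^(M+1) × K^(N+1)`. -/
def ofSpace : (Fin (N + 1) → K) →ₗ[K] (Fin (M + 1) ⊕ Fin (N + 1) → K) :=
  (LinearEquiv.sumArrowLequivProdArrow (Fin (M + 1)) (Fin (N + 1)) K K).symm.toLinearMap ∘ₗ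
    LinearMap.inr K (Fin (M + 1) → K) (Fin (N + 1) → K)

variable {K}

theorem ofSpace_apply (w : Fin (N + 1) → K) : ofSpace K M N w = Sum.elim (0 : Fin (M + 1) → K) w :=
  rfl

variable {M N}

theorem toBase_elim (u : Fin (M + 1) → K) (v : Fin (N + 1) → K) :
    toBase K M N (Sum.elim u v) = u :=
  rfl

theorem toSpace_elim (u : Fin (M + 1) → K) (v : Fin (N + 1) → K) :
    toSpace K M N (Sum.elim u v) = v :=
  rfl

theorem finrank_map_add_finrank_inf_ker {V U : Type*} [AddCommGroup V] [Module K V]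
    [FiniteDimensional K V] [AddCommGroup U] [Module K U] (f : V →ₗ[K] U) (T : Submodule K V) :
    finrank K (T.map f) + finrank K (T ⊓ LinearMap.ker f : Submodule K V) = finrank K T := by
  rw [← LinearMap.finrank_range_add_finrank_ker (f.domRestrict T), LinearMap.range_domRestrict,
    LinearMap.ker_domRestrict, ← Submodule.finrank_map_subtype_eq, Submodule.map_comap_subtype]

namespace Desingularization

variable {k : ℕ} {B : Set (Grass K N k)} (D : Desingularization B)

theorem elim_mem_bicone_incidence_iff {u : Fin (D.M + 1) → K} {v : Fin (N + 1) → K} :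
    Sum.elim u v ∈ bicone D.incidence ↔ ∃ (hu : u ≠ 0) (_ : v ≠ 0)
      (h : Projectivization.mk K u hu ∈ D.carrier), v ∈ (D.toGrass ⟨_, h⟩).1 := by
  rw [elim_mem_bicone_iff]
  exact exists_congr fun hu => exists_congr fun hv => exists_congr fun h => contains_mk_iff hv

theorem toGrass_mk_rep (b : D.carrier)
    (h : Projectivization.mk K b.1.rep b.1.rep_nonzero ∈ D.carrier) :
    D.toGrass ⟨_, h⟩ = D.toGrass b :=
  congrArg D.toGrass (Subtype.ext b.1.mk_rep)

variable {D} {b : D.carrier} {x : ProjSpace K N}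

theorem mem_toGrass_of_ofSpace_mem_incidenceTangent {w : Fin (N + 1) → K}
    (hw : ofSpace K D.M N w ∈ D.incidenceTangent (b.1, x)) : w ∈ (D.toGrass b).1 := by
  obtain ⟨A, E, δ, hδ, hE⟩ := D.regular.exists_frame b
  let G (j : Fin (N + 1)) : MvPolynomial (Fin (D.M + 1) ⊕ Fin (N + 1)) K :=
    rename Sum.inl δ * ∑ l, X (Sum.inr l) * rename Sum.inl (E l j)
  have hG (j : Fin (N + 1)) : G j ∈ vanishingIdeal K (bicone D.incidence) := by
    refine mem_vanishingIdeal_iff_eval.2 ?_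
    rintro _ ⟨u, v, hu, hv, rfl, hY, hc⟩
    simp only [G, map_mul, map_sum, eval_rename, eval_X, Sum.elim_inr, Sum.elim_comp_inl]
    by_cases hδu : eval u δ = 0
    · rw [hδu, zero_mul]
    · rw [show ∑ l, v l * eval u (E l j) = 0 from
        congrFun (((hE u hu hY hδu).2 v).1 ((contains_mk_iff hv).1 hc)) j, mul_zero]
  have hconst (p : MvPolynomial (Fin (D.M + 1)) K) :
      lineRestrict (Sum.elim b.1.rep x.rep) (ofSpace K D.M N w) (rename Sum.inl p) =
        Polynomial.C (eval b.1.rep p) := by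
    rw [lineRestrict, aeval_rename]
    exact (congrArg (fun f => aeval f p) (by ext1; simp [ofSpace_apply])).trans
      (aeval_algebraMap_apply (Polynomial K) b.1.rep p)
  have hb : Projectivization.mk K b.1.rep b.1.rep_nonzero ∈ D.carrier := by
    rw [b.1.mk_rep]
    exact b.2
  rw [← D.toGrass_mk_rep b hb, (hE b.1.rep b.1.rep_nonzero hb hδ).2]
  ext j
  have hj := mem_zariskiTangent_iff.1 hw _ (hG j)
  have hX (l : Fin (N + 1)) :
      lineRestrict (Sum.elim b.1.rep x.rep) (ofSpace K D.M N w) (X (Sum.inr l)) =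
        Polynomial.C (x.rep l) + Polynomial.C (w l) * Polynomial.X := by
    simp [lineRestrict, ofSpace_apply]
  simp only [G, map_mul, map_sum, hconst, hX] at hj
  refine (mul_eq_zero.1 (Eq.trans ?_ hj)).resolve_left hδ
  simp [Polynomial.eval_finsetSum, Matrix.vecMul, dotProduct]

theorem ofSpace_mem_incidenceTangent [Infinite K] (hx : (D.toGrass b).Contains x)
    {w : Fin (N + 1) → K} (hw : w ∈ (D.toGrass b).1) :
    ofSpace K D.M N w ∈ D.incidenceTangent (b.1, x) := by
  have hb : Projectivization.mk K b.1.rep b.1.rep_nonzero ∈ D.carrier := by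
    rw [b.1.mk_rep]
    exact b.2
  have hx' : x.rep ∈ (D.toGrass b).1 := by
    rw [← contains_mk_iff x.rep_nonzero, x.mk_rep]
    exact hx
  have hfin : {t : K | x.rep + t • w = 0}.Finite := by
    refine Set.Subsingleton.finite fun t ht s hs => ?_
    have hw0 : w ≠ 0 := by
      rintro rfl
      exact x.rep_nonzero (by simpa using ht)
    exact smul_left_injective K hw0 (add_left_cancel (ht.trans hs.symm))
  refine mem_zariskiTangent_of_infinite (hfin.infinite_compl.mono fun t ht => ?_)
  have hline : (fun i => Sum.elim b.1.rep x.rep i + ofSpace K D.M N w i * t) =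
      Sum.elim b.1.rep (x.rep + t • w) := by
    ext (i | i) <;> simp [ofSpace_apply, mul_comm]
  change (fun i => Sum.elim b.1.rep x.rep i + ofSpace K D.M N w i * t) ∈ bicone D.incidence
  rw [hline, elim_mem_bicone_incidence_iff]
  refine ⟨b.1.rep_nonzero, ht, hb, ?_⟩
  rw [D.toGrass_mk_rep]
  exact Submodule.add_mem _ hx' (Submodule.smul_mem _ _ hw)

theorem toBase_mem_embTangent {z : Fin (D.M + 1) ⊕ Fin (N + 1) → K}
    (hz : z ∈ D.incidenceTangent (b.1, x)) : toBase K D.M N z ∈ embTangent D.carrier b.1 := by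
  have hmaps : Set.MapsTo (toBase K D.M N) (bicone D.incidence) (cone D.carrier) := by
    rintro _ ⟨u, v, hu, hv, rfl, h, -⟩
    exact ⟨hu, h⟩
  have h := map_mem_zariskiTangent (toBase K D.M N) hmaps hz
  rwa [toBase_elim] at h

variable (b x) in
theorem finrank_incidenceTangent_le :
    finrank K (D.incidenceTangent (b.1, x)) ≤ finrank K (embTangent D.carrier b.1) + (k + 1) := by
  rw [← finrank_map_add_finrank_inf_ker (toBase K D.M N)]
  refine Nat.add_le_add (Submodule.finrank_mono ?_) ?_
  · rintro _ ⟨z, hz, rfl⟩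
    exact toBase_mem_embTangent hz
  · rw [← (D.toGrass b).2]
    refine (Submodule.finrank_mono ?_).trans
      (Submodule.finrank_map_le (ofSpace K D.M N) (D.toGrass b).1)
    rintro z ⟨hz, hz0⟩
    have hvert : ofSpace K D.M N (toSpace K D.M N z) = z := by
      ext (i | i)
      · exact (congrFun hz0 i).symm
      · rfl
    exact ⟨_, mem_toGrass_of_ofSpace_mem_incidenceTangent (x := x) (by rwa [hvert]), hvert⟩

-- At a focus the kernel of the characteristic map has dimension at least `2`, as its source
-- includes the line of `b`, and `τ ↦ (τ, 0)` embeds it into the kernel of `toSpace`.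
theorem finrank_map_toSpace_incidenceTangent_add_two_le
    (hq : ((b.1, x) : BiProjSpace K D.M N) ∈ D.foci) :
    finrank K ((D.incidenceTangent (b.1, x)).map (toSpace K D.M N)) + 2 ≤
      finrank K (D.incidenceTangent (b.1, x)) := by
  rw [← finrank_map_add_finrank_inf_ker (toSpace K D.M N) (D.incidenceTangent (b.1, x))]
  refine Nat.add_le_add_left ?_ _
  let χ := D.characteristicMap (b.1, x)
  let ι : LinearMap.ker χ →ₗ[K]
      (D.incidenceTangent (b.1, x) ⊓ LinearMap.ker (toSpace K D.M N) : Submodule K _) :=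
    LinearMap.codRestrict _
      ((LinearEquiv.sumArrowLequivProdArrow (Fin (D.M + 1)) (Fin (N + 1)) K K).symm.toLinearMap ∘ₗ
        LinearMap.inl K (Fin (D.M + 1) → K) (Fin (N + 1) → K) ∘ₗ Submodule.subtype _ ∘ₗ
          Submodule.subtype _)
      fun τ => ⟨(Submodule.Quotient.mk_eq_zero _).1 τ.2, rfl⟩
  have hι : Function.Injective ι := fun τ τ' h =>
    Subtype.ext (Subtype.ext (funext fun i => congrFun (congrArg Subtype.val h) (Sum.inl i)))
  have hker := LinearMap.finrank_range_add_finrank_ker χ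
  have hrank : finrank K (LinearMap.range χ) < finrank K (embTangent D.carrier b.1) - 1 :=
    hq.2.trans_le (min_le_left _ _)
  have hle := LinearMap.finrank_le_finrank_of_injective hι
  lia

theorem le_embTangent_focalLocus [Infinite K] {n : ℕ}
    (hq : ((b.1, x) : BiProjSpace K D.M N) ∈ D.foci)
    (hb : finrank K (embTangent D.carrier b.1) ≤ n + 1)
    {W : Set (BiProjSpace K D.M N)} (hW : W ⊆ D.foci)
    (hdim : n + k ≤ finrank K
      ((zariskiTangent (bicone W) (Sum.elim b.1.rep x.rep)).map (toSpace K D.M N))) :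
    (D.toGrass b).1 ≤ embTangent D.focalLocus x := by
  have hle : (zariskiTangent (bicone W) (Sum.elim b.1.rep x.rep)).map (toSpace K D.M N) ≤
      (D.incidenceTangent (b.1, x)).map (toSpace K D.M N) := by
    refine Submodule.map_mono (zariskiTangent_mono ?_ _)
    rintro _ ⟨u, v, hu, hv, rfl, h⟩
    exact ⟨u, v, hu, hv, rfl, (hW h).1⟩
  have heq := Submodule.eq_of_le_of_finrank_le hle (by
    have := finrank_map_toSpace_incidenceTangent_add_two_le hq
    have := finrank_incidenceTangent_le b x
    lia)
  intro w hw
  have hmem : w ∈ (D.incidenceTangent (b.1, x)).map (toSpace K D.M N) :=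
    ⟨_, ofSpace_mem_incidenceTangent hq.1.2 hw, rfl⟩
  rw [← heq] at hmem
  obtain ⟨z, hz, rfl⟩ := hmem
  have hmaps : Set.MapsTo (toSpace K D.M N) (bicone W) (cone D.focalLocus) := by
    rintro _ ⟨u, v, hu, hv, rfl, h⟩
    exact ⟨hv, _, hW h, rfl⟩
  have h := map_mem_zariskiTangent (toSpace K D.M N) hmaps hz
  rwa [toSpace_elim] at h

end Desingularization

end IncidenceTangent

/-! ### Dimension of quasi-affine varieties -/

section QuasiAffine

variable {K σ : Type*} [Field K] [IsAlgClosed K] [Finite σ] {V : Set (σ → K)}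
  {h : MvPolynomial σ K} {J : Ideal (MvPolynomial σ K)} [J.IsPrime]

theorem exists_mem_eval_ne_zero_of_notMem (hh : h ∉ J)
    (hV : ∀ v, (∀ p ∈ J, eval v p = 0) → eval v h ≠ 0 → v ∈ V) {p : MvPolynomial σ K}
    (hp : p ∉ J) : ∃ v : V, (∀ q ∈ J, eval v.1 q = 0) ∧ eval v.1 p ≠ 0 := by
  have hph : p * h ∉ J := fun hcon => (Ideal.IsPrime.mem_or_mem ‹_› hcon).elim hp hh
  rw [← IsPrime.vanishingIdeal_zeroLocus (K := K) J, mem_vanishingIdeal_iff_eval] at hph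
  push Not at hph
  obtain ⟨v, hv, hne⟩ := hph
  rw [map_mul] at hne
  exact ⟨⟨v, hV v hv (right_ne_zero_of_mul hne)⟩, hv, left_ne_zero_of_mul hne⟩

theorem isIrreducible_setOf_forall_eval_eq_zero (hh : h ∉ J)
    (hV : ∀ v, (∀ p ∈ J, eval v p = 0) → eval v h ≠ 0 → v ∈ V) :
    @IsIrreducible V (.induced Subtype.val (zariski K σ))
      {v : V | ∀ p ∈ J, eval v.1 p = 0} := by
  let : TopologicalSpace V := .induced Subtype.val (zariski K σ)
  refine ⟨?_, isPreirreducible_iff_isClosed_union_isClosed.2 fun Z₁ Z₂ h₁ h₂ hZ => ?_⟩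
  · obtain ⟨v, hv, -⟩ := exists_mem_eval_ne_zero_of_notMem hh hV
      ((Ideal.ne_top_iff_one _).1 Ideal.IsPrime.ne_top')
    exact ⟨v, hv⟩
  · obtain ⟨S₁, hS₁⟩ := isClosed_induced_zariski_iff.1 h₁
    obtain ⟨S₂, hS₂⟩ := isClosed_induced_zariski_iff.1 h₂
    by_contra! hcon
    obtain ⟨⟨v₁, hv₁, hn₁⟩, v₂, hv₂, hn₂⟩ := hcon.imp Set.not_subset.1 Set.not_subset.1
    rw [hS₁] at hn₁
    rw [hS₂] at hn₂
    push Not at hn₁ hn₂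
    obtain ⟨p₁, hp₁, hne₁⟩ := hn₁
    obtain ⟨p₂, hp₂, hne₂⟩ := hn₂
    have hmul : p₁ * p₂ ∉ J := fun hcon => (Ideal.IsPrime.mem_or_mem ‹_› hcon).elim
      (fun h => hne₁ (hv₁ _ h)) (fun h => hne₂ (hv₂ _ h))
    obtain ⟨v, hv, hne⟩ := exists_mem_eval_ne_zero_of_notMem hh hV hmul
    rw [map_mul] at hne
    exact (hZ hv).elim (fun h => left_ne_zero_of_mul hne ((hS₁ v).1 h _ hp₁))
      fun h => right_ne_zero_of_mul hne ((hS₂ v).1 h _ hp₂)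

theorem length_le_topologicalKrullDim (l : LTSeries (PrimeSpectrum (MvPolynomial σ K)))
    (hl : ∀ i, h ∉ (l i).asIdeal)
    (hV : ∀ i v, (∀ p ∈ (l i).asIdeal, eval v p = 0) → eval v h ≠ 0 → v ∈ V) :
    (l.length : WithBot ℕ∞) ≤
      @topologicalKrullDim V (.induced Subtype.val (zariski K σ)) := by
  let : TopologicalSpace V := .induced Subtype.val (zariski K σ)
  let Z (i : Fin (l.length + 1)) : TopologicalSpace.IrreducibleCloseds V :=
    ⟨{v | ∀ p ∈ (l i).asIdeal, eval v.1 p = 0},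
      isIrreducible_setOf_forall_eval_eq_zero (hl i) (hV i),
      isClosed_induced_zariski_iff.2 ⟨(l i).asIdeal, fun v => Iff.rfl⟩⟩
  have hZ : StrictMono fun i => OrderDual.toDual (Z i) := by
    intro i j hij
    have hlt : (l i).asIdeal < (l j).asIdeal := l.strictMono hij
    obtain ⟨p, hpj, hpi⟩ := SetLike.exists_of_lt hlt
    refine lt_of_le_not_ge (fun v (hv : v ∈ Z j) p hp => hv p (hlt.le hp)) fun hcon => ?_
    obtain ⟨v, hv, hne⟩ := exists_mem_eval_ne_zero_of_notMem (hl i) (hV i) hpi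
    exact hne ((show v ∈ Z j from hcon hv) p hpj)
  have hlen := Order.LTSeries.length_le_krullDim (LTSeries.mk l.length _ hZ)
  rwa [Order.krullDim_orderDual] at hlen

end QuasiAffine

/-! ### The quotient map from frames to the Grassmannian -/

section FrameQuotient

variable {K : Type*} [Field K] {N k : ℕ}

theorem Grass.isClosed_iff {Z : Set (Grass K N k)} :
    IsClosed Z ↔ ∃ S : Set (MvPolynomial (Fin (k + 1) × Fin (N + 1)) K),
      ∀ A : Frame K N k, A.span ∈ Z ↔ ∀ p ∈ S, eval (entries A.1) p = 0 :=
  isClosed_coinduced_zariski_iff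

theorem Frame.span_eq_span_iff {A A' : Frame K N k} :
    A'.span = A.span ↔ ∃ g : Matrix (Fin (k + 1)) (Fin (k + 1)) K,
      IsUnit g ∧ Matrix.of A'.1 = g * Matrix.of A.1 := by
  constructor
  · intro h
    have hmem (i : Fin (k + 1)) : ∃ a, a ᵥ* Matrix.of A.1 = A'.1 i := by
      have hi : A'.1 i ∈ (A.span).1 := h ▸ Submodule.subset_span ⟨i, rfl⟩
      change A'.1 i ∈ Submodule.span K (Set.range (Matrix.of A.1).row) at hi
      rwa [← range_vecMulLinear] at hi
    choose g hg using hmem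
    have hgA : Matrix.of A'.1 = Matrix.of g * Matrix.of A.1 := funext fun i => (hg i).symm
    refine ⟨Matrix.of g, Matrix.vecMul_injective_iff_isUnit.1 ?_, hgA⟩
    refine Function.Injective.of_comp (f := fun v => v ᵥ* Matrix.of A.1) ?_
    simpa only [Function.comp_def, Matrix.vecMul_vecMul, ← hgA] using
      (Matrix.vecMul_injective_iff (M := Matrix.of A'.1)).2 A'.2
  · rintro ⟨g, -, hg⟩
    refine Subtype.ext (Submodule.eq_of_le_of_finrank_eq (Submodule.span_le.2 ?_) ?_)
    · rintro _ ⟨i, rfl⟩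
      change Matrix.of A'.1 i ∈ Submodule.span K (Set.range (Matrix.of A.1).row)
      rw [← range_vecMulLinear, hg]
      exact ⟨g i, rfl⟩
    · exact A'.span.2.trans A.span.2.symm

theorem isOpen_setOf_exists_frame (r : MvPolynomial (Fin (k + 1) × Fin (N + 1)) K) :
    IsOpen {L : Grass K N k | ∃ A : Frame K N k, A.span = L ∧ eval (entries A.1) r ≠ 0} := by
  rw [← isClosed_compl_iff, Grass.isClosed_iff]
  let translate (g : Matrix (Fin (k + 1)) (Fin (k + 1)) K) :
      MvPolynomial (Fin (k + 1) × Fin (N + 1)) K :=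
    aeval (fun ij => ∑ l, C (g ij.1 l) * X (l, ij.2)) r
  have heval (g : Matrix (Fin (k + 1)) (Fin (k + 1)) K) (A : Matrix (Fin (k + 1)) (Fin (N + 1)) K) :
      eval (entries A) (translate g) = eval (entries (g * A)) r := by
    rw [eval_aeval]
    congr 2
    ext ij
    simp [entries, Matrix.mul_apply]
  refine ⟨{p | ∃ g, IsUnit g ∧ p = translate g}, fun A => ⟨?_, ?_⟩⟩
  · rintro hA p ⟨g, hg, rfl⟩
    by_contra hne
    have hind : LinearIndependent K (g * Matrix.of A.1).row := by
      rw [← Matrix.vecMul_injective_iff]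
      simpa only [Function.comp_def, Matrix.vecMul_vecMul] using
        (Matrix.vecMul_injective_iff (M := Matrix.of A.1)).2 A.2 |>.comp
          (Matrix.vecMul_injective_iff_isUnit.2 hg)
    exact hA ⟨⟨_, hind⟩, Frame.span_eq_span_iff.2 ⟨g, hg, rfl⟩, heval g A.1 ▸ hne⟩
  · rintro h ⟨A', hspan, hne⟩
    obtain ⟨g, hg, hgA⟩ := Frame.span_eq_span_iff.1 hspan
    exact hne ((congrArg (fun A => eval (entries A) r) hgA).trans
      ((heval g A.1).symm.trans (h _ ⟨g, hg, rfl⟩)))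

variable {σ : Type*} (A : Matrix (Fin (k + 1)) (Fin (N + 1)) (MvPolynomial σ K))

theorem eval_aeval_entries (u : σ → K) (p : MvPolynomial (Fin (k + 1) × Fin (N + 1)) K) :
    eval u (aeval (entries A) p) = eval (entries (A.map (eval u)).row) p :=
  eval_aeval u _ p

variable {A}

theorem exists_eval_ne_zero_forall_span_mem {O : Set (Grass K N k)} (hO : IsOpen O) {u₀ : σ → K}
    (hA : LinearIndependent K (A.map (eval u₀)).row)
    (hmem : Frame.span ⟨(A.map (eval u₀)).row, hA⟩ ∈ O) :
    ∃ s : MvPolynomial σ K, eval u₀ s ≠ 0 ∧ ∀ (u : σ → K)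
      (hA : LinearIndependent K (A.map (eval u)).row), eval u s ≠ 0 →
        Frame.span ⟨(A.map (eval u)).row, hA⟩ ∈ O := by
  obtain ⟨S, hS⟩ := Grass.isClosed_iff.1 hO.isClosed_compl
  have hex := mt (hS ⟨_, hA⟩).2 (not_not.2 hmem)
  push Not at hex
  obtain ⟨s, hs, hne⟩ := hex
  refine ⟨aeval (entries A) s, by rwa [eval_aeval_entries], fun u hu hne => ?_⟩
  by_contra hcon
  exact hne ((eval_aeval_entries A u s).trans ((hS ⟨_, hu⟩).1 hcon s hs))

theorem exists_eval_eq_pow_mul_eval_div {ι τ : Type*} (f : ι → MvPolynomial τ K)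
    (g : MvPolynomial τ K) (p : MvPolynomial ι K) :
    ∃ (m : ℕ) (r : MvPolynomial τ K), ∀ t, eval t g ≠ 0 →
      eval t r = eval t g ^ m * eval (fun i => eval t (f i) / eval t g) p := by
  induction p using MvPolynomial.induction_on with
  | C a => exact ⟨0, C a, fun t _ => by simp⟩
  | add p q hp hq =>
    obtain ⟨m, r, hr⟩ := hp
    obtain ⟨m', r', hr'⟩ := hq
    refine ⟨m + m', g ^ m' * r + g ^ m * r', fun t ht => ?_⟩
    simp only [map_add, map_mul, map_pow, hr t ht, hr' t ht]
    ring
  | mul_X p i hp =>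
    obtain ⟨m, r, hr⟩ := hp
    refine ⟨m + 1, r * f i, fun t ht => ?_⟩
    simp only [map_mul, hr t ht, eval_X]
    field_simp
    ring

variable {V : Set (σ → K)} {ψ : V → Grass K N k}

theorem continuous_of_eq_span
    (hψ : ∀ u : V, ∃ hA : LinearIndependent K (A.map (eval u.1)).row, ψ u = Frame.span ⟨_, hA⟩) :
    @Continuous _ _ (.induced Subtype.val (zariski K σ)) _ ψ := by
  let : TopologicalSpace V := .induced Subtype.val (zariski K σ)
  refine continuous_iff_isClosed.2 fun Z hZ => ?_
  obtain ⟨S, hS⟩ := Grass.isClosed_iff.1 hZ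
  refine isClosed_induced_zariski_iff.2 ⟨aeval (entries A) '' S, fun u => ?_⟩
  obtain ⟨hA, hspan⟩ := hψ u
  rw [Set.mem_preimage, hspan, hS, Set.forall_mem_image]
  simp only [eval_aeval_entries]

theorem isInducing_of_rational_inverse
    (hψ : ∀ u : V, ∃ hA : LinearIndependent K (A.map (eval u.1)).row, ψ u = Frame.span ⟨_, hA⟩)
    (f : σ → MvPolynomial (Fin (k + 1) × Fin (N + 1)) K)
    (g : MvPolynomial (Fin (k + 1) × Fin (N + 1)) K)
    (hg : ∀ u : V, eval (entries (A.map (eval u.1)).row) g ≠ 0)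
    (hinv : ∀ (u : V) (A' : Frame K N k), A'.span = ψ u → eval (entries A'.1) g ≠ 0 →
      (fun i => eval (entries A'.1) (f i) / eval (entries A'.1) g) = u.1) :
    @Topology.IsInducing _ _ (.induced Subtype.val (zariski K σ)) _ ψ := by
  let : TopologicalSpace V := .induced Subtype.val (zariski K σ)
  refine ⟨TopologicalSpace.ext_iff_isClosed.2 fun Z => ⟨fun hZ => ?_, fun hZ => ?_⟩⟩
  · obtain ⟨T, hT⟩ := isClosed_induced_zariski_iff.1 hZ
    choose m r hr using exists_eval_eq_pow_mul_eval_div f g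
    have hU : IsOpen (⋃ p ∈ T, {L : Grass K N k | ∃ A' : Frame K N k, A'.span = L ∧
        eval (entries A'.1) (r p * g) ≠ 0}) :=
      isOpen_biUnion fun p _ => isOpen_setOf_exists_frame _
    refine isClosed_induced_iff.2 ⟨_, hU.isClosed_compl, Set.ext fun u => ?_⟩
    rw [hT, Set.mem_preimage, Set.mem_compl_iff]
    simp only [Set.mem_iUnion, Set.mem_ofPred_eq, not_exists, not_and, ne_eq, not_not]
    refine ⟨fun hu p hp => ?_, fun hu p hp A' hA' => ?_⟩
    · obtain ⟨hA, hspan⟩ := hψ u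
      have h0 := hu p hp ⟨_, hA⟩ hspan.symm
      rw [map_mul, hr p _ (hg u), hinv u ⟨_, hA⟩ hspan.symm (hg u)] at h0
      exact (mul_eq_zero.1 ((mul_eq_zero.1 h0).resolve_right (hg u))).resolve_left
        (pow_ne_zero _ (hg u))
    · by_cases hg' : eval (entries A'.1) g = 0
      · rw [map_mul, hg', mul_zero]
      · rw [map_mul, hr p _ hg', hinv u A' hA' hg', hu p hp, mul_zero, zero_mul]
  · obtain ⟨T, hT, rfl⟩ := isClosed_induced_iff.1 hZ
    exact hT.preimage (continuous_of_eq_span hψ)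

end FrameQuotient

/-! ### The dimension of a desingularization -/

theorem mk_mem_of_isClosed {K : Type*} [Field K] {N : ℕ} {Z : Set (ProjSpace K N)}
    (hZ : IsClosed Z) {v : Fin (N + 1) → K} (hv : v ≠ 0)
    (h : ∀ p ∈ vanishingIdeal K (cone Z), eval v p = 0) : Projectivization.mk K v hv ∈ Z := by
  obtain ⟨S, hS⟩ := isClosed_projSpace_iff.1 hZ
  rw [hS]
  exact fun p hp => h p (mem_vanishingIdeal_iff_eval.2 fun w ⟨hw, hwZ⟩ => (hS w hw).1 hwZ p hp)

namespace Desingularization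

section Field

variable {K : Type*} [Field K] {N k : ℕ} {B : Set (Grass K N k)} (D : Desingularization B)

theorem toGrass_mem (b : D.carrier) : D.toGrass b ∈ B :=
  D.range_eq.subset (Set.mem_range_self b)

theorem exists_isOpen_forall_eq_smul :
    ∃ (O : Set (Grass K N k)) (b₀ : D.carrier), IsOpen O ∧ D.toGrass b₀ ∈ O ∧
      ∀ A₀ : Frame K N k, A₀.span = D.toGrass b₀ →
        ∃ (P : Fin (D.M + 1) → MvPolynomial (Fin (k + 1) × Fin (N + 1)) K) (j : Fin (D.M + 1)),
          eval (entries A₀.1) (P j) ≠ 0 ∧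
          ∀ (u : Fin (D.M + 1) → K) (hu : u ≠ 0) (hY : Projectivization.mk K u hu ∈ D.carrier),
            D.toGrass ⟨_, hY⟩ ∈ O → ∀ A : Frame K N k, A.span = D.toGrass ⟨_, hY⟩ →
              eval (entries A.1) (P j) ≠ 0 →
                ∃ a : K, a ≠ 0 ∧ u = a • fun i => eval (entries A.1) (P i) := by
  obtain ⟨O, hO, ⟨L₀, hL₀⟩, σ, hσ, hσD⟩ := D.birational
  obtain ⟨b₀, rfl⟩ : L₀ ∈ Set.range D.toGrass := D.range_eq.superset hL₀.1
  refine ⟨O, b₀, hO, hL₀.2, fun A₀ hA₀ => ?_⟩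
  obtain ⟨P, hP₀, hP⟩ := hσ A₀ (hA₀ ▸ hL₀)
  obtain ⟨j, hj⟩ := Function.ne_iff.1 hP₀
  refine ⟨P, j, hj, fun u hu hY hmem A hA hPA => ?_⟩
  have hBO : D.toGrass ⟨_, hY⟩ ∈ B ∩ O := ⟨D.toGrass_mem _, hmem⟩
  have hne : (fun i => eval (entries A.1) (P i)) ≠ 0 := fun h => hPA (congrFun h j)
  rw [← mk_eq_mk_iff_exists_ne_zero hu hne, ← hP A (hA ▸ hBO) hne]
  exact (hσD ⟨_, hY⟩ hBO).symm.trans (congrArg σ (Subtype.ext hA.symm))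

theorem exists_frame_inverse :
    ∃ (A : Matrix (Fin (k + 1)) (Fin (N + 1)) (MvPolynomial (Fin (D.M + 1)) K))
      (P : Fin (D.M + 1) → MvPolynomial (Fin (k + 1) × Fin (N + 1)) K) (j : Fin (D.M + 1))
      (h : MvPolynomial (Fin (D.M + 1)) K), h ∉ vanishingIdeal K (cone D.carrier) ∧
      ∀ u : Fin (D.M + 1) → K, eval u h ≠ 0 →
        u j ≠ 0 ∧ eval (entries (A.map (eval u)).row) (P j) ≠ 0 ∧
        ∀ (hu : u ≠ 0) (hY : Projectivization.mk K u hu ∈ D.carrier),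
          (∃ hA : LinearIndependent K (A.map (eval u)).row,
            D.toGrass ⟨_, hY⟩ = Frame.span ⟨_, hA⟩) ∧
          ∀ A' : Frame K N k, A'.span = D.toGrass ⟨_, hY⟩ → eval (entries A'.1) (P j) ≠ 0 →
            ∃ a : K, a ≠ 0 ∧ u = a • fun i => eval (entries A'.1) (P i) := by
  obtain ⟨O, b₀, hO, hb₀, hinv⟩ := D.exists_isOpen_forall_eq_smul
  obtain ⟨A, _, δ, hδ, hA⟩ := D.regular.exists_frame b₀
  have hmk := (rep_mem_cone b₀.2).2
  have hb₀' := D.toGrass_mk_rep b₀ hmk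
  obtain ⟨⟨hA₀, hspan₀⟩, -⟩ := hA _ b₀.1.rep_nonzero hmk hδ
  obtain ⟨P, j, hPj, hP⟩ := hinv _ (hspan₀.symm.trans hb₀')
  obtain ⟨s, hs, hsO⟩ := exists_eval_ne_zero_forall_span_mem hO hA₀ (by rwa [← hspan₀, hb₀'])
  have hj : b₀.1.rep j ≠ 0 := by
    obtain ⟨a, ha, hrep⟩ := hP _ b₀.1.rep_nonzero hmk (by rwa [hb₀']) _ hspan₀.symm hPj
    rw [hrep]
    exact mul_ne_zero ha hPj
  have heval (u : Fin (D.M + 1) → K) : eval u (δ * s * aeval (entries A) (P j) * X j) =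
      eval u δ * eval u s * eval (entries (A.map (eval u)).row) (P j) * u j := by
    rw [map_mul, map_mul, map_mul, eval_aeval_entries, eval_X]
  refine ⟨A, P, j, δ * s * aeval (entries A) (P j) * X j, fun hcon => ?_, fun u hu => ?_⟩
  · refine mul_ne_zero (mul_ne_zero (mul_ne_zero hδ hs) hPj) hj ?_
    rw [← heval]
    exact mem_vanishingIdeal_iff_eval.1 hcon _ (rep_mem_cone b₀.2)
  · simp only [heval, mul_ne_zero_iff] at hu
    obtain ⟨⟨⟨hδu, hsu⟩, hPu⟩, hju⟩ := hu
    refine ⟨hju, hPu, fun hu hY => ?_⟩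
    obtain ⟨⟨hAu, hspan⟩, -⟩ := hA u hu hY hδu
    exact ⟨⟨hAu, hspan⟩, hP u hu hY (hspan ▸ hsO u hAu hsu)⟩

end Field

section IsAlgClosed

variable {K : Type*} [Field K] [IsAlgClosed K] {N k n : ℕ} {B : Set (Grass K N k)}
  (D : Desingularization B)

-- Normalizing one homogeneous coordinate of `B'` to a suitable constant `c` embeds an open part of
-- `B'` into `B`, because the regular inverse over `B ∩ O` recovers the coordinates up to a factor.
theorem le_topologicalKrullDim {d : ℕ} (hd : ((d + 1 : ℕ) : WithBot ℕ∞) ≤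
      ringKrullDim (MvPolynomial (Fin (D.M + 1)) K ⧸ vanishingIdeal K (cone D.carrier))) :
    (d : WithBot ℕ∞) ≤ topologicalKrullDim B := by
  have hprime := isPrime_vanishingIdeal_cone D.isIrreducible_carrier
  obtain ⟨A, P, j, h, hh, hA⟩ := D.exists_frame_inverse
  obtain ⟨c, l, rfl, hl⟩ := exists_ltSeries_hyperplane _ hh j hd
  let V : Set (Fin (D.M + 1) → K) := {u |
    (∀ p ∈ vanishingIdeal K (cone D.carrier), eval u p = 0) ∧ u j = c ∧ eval u h ≠ 0}
  have hu (u : V) : u.1 ≠ 0 := fun h0 => (hA u.1 u.2.2.2).1 (congrFun h0 j)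
  have hY (u : V) : Projectivization.mk K u.1 (hu u) ∈ D.carrier :=
    mk_mem_of_isClosed D.isClosed_carrier _ u.2.1
  let ψ (u : V) : Grass K N k := D.toGrass ⟨_, hY u⟩
  have hinv (u : V) (A' : Frame K N k) (hA' : A'.span = ψ u)
      (hne : eval (entries A'.1) (P j) ≠ 0) :
      (fun i => eval (entries A'.1) (C c * P i) / eval (entries A'.1) (P j)) = u.1 := by
    obtain ⟨a, -, hua⟩ := ((hA u.1 u.2.2.2).2.2 (hu u) (hY u)).2 A' hA' hne
    have hc : a * eval (entries A'.1) (P j) = c := (congrFun hua j).symm.trans u.2.2.1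
    ext i
    rw [hua, ← hc, map_mul, eval_C, Pi.smul_apply, smul_eq_mul]
    field_simp
  let : TopologicalSpace V := .induced Subtype.val (zariski K _)
  have hψ : Topology.IsInducing ψ :=
    isInducing_of_rational_inverse (fun u => ((hA u.1 u.2.2.2).2.2 (hu u) (hY u)).1)
      (fun i => C c * P i) (P j) (fun u => (hA u.1 u.2.2.2).2.1) hinv
  calc (l.length : WithBot ℕ∞) ≤ topologicalKrullDim V :=
        length_le_topologicalKrullDim l (fun i => (hl i).2.1) fun i v hv hvh => by
          have hvj := hv _ (hl i).2.2
          rw [map_sub, eval_X, eval_C, sub_eq_zero] at hvj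
          exact ⟨fun p hp => hv p ((hl i).1 hp), hvj, hvh⟩
    _ ≤ topologicalKrullDim B :=
        (hψ.codRestrict fun u => D.toGrass_mem ⟨_, hY u⟩).topologicalKrullDim_le

theorem finrank_embTangent_le (hB : topologicalKrullDim B ≤ (n : WithBot ℕ∞)) (b : D.carrier) :
    finrank K (embTangent D.carrier b.1) ≤ n + 1 := by
  have hd := topologicalKrullDim_add_one_le (K := K) ⟨b.1, b.2⟩
  rw [← D.nonsingular b.1 b.2] at hd
  rcases h : finrank K (embTangent D.carrier b.1) with _ | d
  · exact Nat.zero_le _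
  · rw [h] at hd
    exact Nat.succ_le_succ (by exact_mod_cast (D.le_topologicalKrullDim hd).trans hB)

end IsAlgClosed

end Desingularization

/-! ### Ranks of projections at a general point -/

section GeneralRank

theorem exists_forall_mem_zariskiTangent {K σ ι : Type*} [Field K] [CharZero K] [Fintype σ]
    [Finite ι] [DecidableEq ι] {S : Set (σ → K)} [(vanishingIdeal K S).IsPrime] (x : ι → σ)
    (hx : AlgebraicIndependent K fun i => Ideal.Quotient.mk (vanishingIdeal K S) (X (x i))) :
    ∃ H ∉ vanishingIdeal K S, ∀ z ∈ S, ∃ w : ι → σ → K,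
      (∀ i, w i ∈ zariskiTangent S z) ∧ ∀ i j, w i (x j) = if i = j then eval z H else 0 := by
  obtain ⟨H, hH, w, hwx, hwp⟩ := exists_tangent_vectors _ x hx
  refine ⟨H, hH, fun z hz => ⟨fun i s => eval z (w i s), fun i p hp => ?_, fun i j => ?_⟩⟩
  · have h := mem_vanishingIdeal_iff_eval.1 (hwp i p (mem_vanishingIdeal_iff_eval.2 hp)) z hz
    simpa only [map_sum, map_mul] using h
  · have h := mem_vanishingIdeal_iff_eval.1 (hwx i j) z hz
    rw [map_sub, sub_eq_zero] at h
    exact h.trans ((apply_ite (eval z) ..).trans (by rw [map_zero]))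

theorem linearIndependent_of_apply_eq_ite {K σ ι : Type*} [Field K] [Finite ι] [DecidableEq ι]
    {w : ι → σ → K} {x : ι → σ} {a : K} (ha : a ≠ 0)
    (hw : ∀ i j, w i (x j) = if i = j then a else 0) : LinearIndependent K w := by
  cases nonempty_fintype ι
  refine Fintype.linearIndependent_iff.2 fun c hc j => ?_
  have h := congrFun hc (x j)
  simp only [Finset.sum_apply, Pi.smul_apply, hw, smul_eq_mul, mul_ite, mul_zero,
    Finset.sum_ite_eq', Finset.mem_univ, if_true, Pi.zero_apply] at h
  exact (mul_eq_zero.1 h).resolve_right ha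

variable {K : Type*} [Field K] {M N : ℕ}

theorem vanishingIdeal_cone_snd_image (W : Set (BiProjSpace K M N)) :
    vanishingIdeal K (cone ((fun q : BiProjSpace K M N => q.2) '' W)) =
      (vanishingIdeal K (bicone W)).comap
        (rename Sum.inr : MvPolynomial (Fin (N + 1)) K →ₐ[K] _) := by
  ext p
  rw [Ideal.mem_comap, mem_vanishingIdeal_iff_eval, mem_vanishingIdeal_iff_eval]
  constructor
  · rintro h _ ⟨u, v, hu, hv, rfl, hq⟩
    rw [eval_rename, Sum.elim_comp_inr]
    exact h v ⟨hv, _, hq, rfl⟩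
  · rintro h v ⟨hv, ⟨y, _⟩, hq, rfl⟩
    have hz := h (Sum.elim y.rep v)
      (elim_mem_bicone_iff.2 ⟨y.rep_nonzero, hv, by rwa [y.mk_rep]⟩)
    rwa [eval_rename, Sum.elim_comp_inr] at hz

theorem exists_le_finrank_map_toSpace [CharZero K] {W : Set (BiProjSpace K M N)}
    (hW : IsIrreducible W) {e : ℕ}
    (he : (e : WithBot ℕ∞) ≤ topologicalKrullDim ((fun q : BiProjSpace K M N => q.2) '' W) + 1) :
    ∃ H ∉ vanishingIdeal K (bicone W), ∀ z ∈ bicone W, eval z H ≠ 0 →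
      e ≤ finrank K ((zariskiTangent (bicone W) z).map (toSpace K M N)) := by
  have hP := isPrime_vanishingIdeal_bicone hW
  replace he := he.trans (topologicalKrullDim_add_one_le (K := K) (hW.nonempty.image _))
  let f : MvPolynomial (Fin (N + 1)) K →ₐ[K] MvPolynomial (Fin (M + 1) ⊕ Fin (N + 1)) K :=
    rename Sum.inr
  rw [vanishingIdeal_cone_snd_image] at he
  obtain ⟨x, hx⟩ := exists_algebraicIndependent_X _ he
  have hx' : AlgebraicIndependent K fun a =>
      Ideal.Quotient.mk (vanishingIdeal K (bicone W)) (X (Sum.inr (x a))) := by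
    have h := hx.map' (f := Ideal.quotientMapₐ (vanishingIdeal K (bicone W)) f le_rfl)
      Ideal.quotientMap_injective
    convert h using 1
    · ext a
      simp [f]
    · rfl
  obtain ⟨H, hH, hw⟩ := exists_forall_mem_zariskiTangent _ hx'
  refine ⟨H, hH, fun z hz hHz => ?_⟩
  obtain ⟨w, hwz, hwx⟩ := hw z hz
  have hlin : LinearIndependent K fun a => toSpace K M N (w a) :=
    linearIndependent_of_apply_eq_ite (x := x) hHz hwx
  have hspan : Submodule.span K (Set.range fun a => toSpace K M N (w a)) ≤
      (zariskiTangent (bicone W) z).map (toSpace K M N) :=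
    Submodule.span_le.2 (Set.range_subset_iff.2 fun a => ⟨_, hwz a, rfl⟩)
  simpa [finrank_span_eq_card hlin] using Submodule.finrank_mono hspan

theorem map_toSpace_zariskiTangent_le {W : Set (BiProjSpace K M N)} {s t : K} (hs : s ≠ 0)
    (ht : t ≠ 0) (u : Fin (M + 1) → K) (v : Fin (N + 1) → K) :
    (zariskiTangent (bicone W) (Sum.elim u v)).map (toSpace K M N) ≤
      (zariskiTangent (bicone W) (Sum.elim (s • u) (t • v))).map (toSpace K M N) := by
  let L : (Fin (M + 1) ⊕ Fin (N + 1) → K) →ₗ[K] Fin (M + 1) ⊕ Fin (N + 1) → K :=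
    LinearMap.mulLeft K (Sum.elim (fun _ => s) fun _ => t)
  have hL (u : Fin (M + 1) → K) (v : Fin (N + 1) → K) :
      L (Sum.elim u v) = Sum.elim (s • u) (t • v) := by
    ext (i | i) <;> rfl
  have hmaps : Set.MapsTo L (bicone W) (bicone W) := by
    rintro _ ⟨u, v, hu, hv, rfl, hW⟩
    rw [hL]
    exact smul_elim_smul_mem_bicone hs ht ⟨u, v, hu, hv, rfl, hW⟩
  rintro _ ⟨w, hw, rfl⟩
  refine (Submodule.smul_mem_iff _ ht).1 ⟨L w, ?_, rfl⟩
  rw [← hL]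
  exact map_mem_zariskiTangent L hmaps hw

end GeneralRank

/-! ### Irreducible components -/

section Components

variable {E : Type*} [TopologicalSpace E]

theorem isIrreducible_preimage_val {S Z : Set E} (hZ : IsIrreducible Z) (hZS : Z ⊆ S) :
    IsIrreducible (Subtype.val ⁻¹' Z : Set S) := by
  have := Subtype.irreducibleSpace hZ
  have h := (IrreducibleSpace.isIrreducible_univ Z).image _
    (continuous_inclusion hZS).continuousOn
  rwa [Set.image_univ, Set.range_inclusion] at h

theorem exists_finite_maximal_isIrreducible [TopologicalSpace.NoetherianSpace E] (S : Set E) :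
    ∃ C : Set (Set E), C.Finite ∧ (∀ W ∈ C, Maximal (fun Z => IsIrreducible Z ∧ Z ⊆ S) W) ∧
      ⋃₀ C = S := by
  have : TopologicalSpace.NoetherianSpace S := Topology.IsInducing.subtypeVal.noetherianSpace
  have hmax : ∀ W ∈ Set.image Subtype.val '' irreducibleComponents S,
      Maximal (fun Z => IsIrreducible Z ∧ Z ⊆ S) W := by
    rintro _ ⟨W, hW, rfl⟩
    refine ⟨⟨hW.1.image _ continuous_subtype_val.continuousOn, Subtype.coe_image_subset S W⟩,
      fun Z hZ hWZ => ?_⟩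
    have hZW := hW.2 (isIrreducible_preimage_val hZ.1 hZ.2) (Set.image_subset_iff.1 hWZ)
    rw [← Set.inter_eq_right.2 hZ.2, ← Subtype.image_preimage_coe]
    exact Set.image_mono hZW
  refine ⟨_, TopologicalSpace.NoetherianSpace.finite_irreducibleComponents.image _, hmax,
    subset_antisymm (Set.sUnion_subset fun W hW => (hmax W hW).1.2) fun x hx => ?_⟩
  exact ⟨_, ⟨_, irreducibleComponent_mem_irreducibleComponents ⟨x, hx⟩, rfl⟩, _,
    mem_irreducibleComponent, rfl⟩

theorem exists_isOpen_nonempty_inter {ι : Type*} {B : Set E}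
    (hB : IsIrreducible B) {C : Set ι} (hC : C.Finite) (T : ι → Set E) :
    ∃ O, IsOpen O ∧ (B ∩ O).Nonempty ∧ ∀ i ∈ C, (O ∩ T i).Nonempty → B ⊆ closure (T i) := by
  classical
  let C' := {i ∈ C | ¬ B ⊆ closure (T i)}
  have hC' : C'.Finite := hC.subset (Set.sep_subset _ _)
  refine ⟨(⋃ i ∈ C', closure (T i))ᶜ,
    (hC'.isClosed_biUnion fun _ _ => isClosed_closure).isOpen_compl, ?_, ?_⟩
  · by_contra hcon
    rw [← Set.sdiff_eq, Set.not_nonempty_iff_eq_empty, Set.sdiff_eq_empty] at hcon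
    obtain ⟨Z, hZ, hBZ⟩ := isIrreducible_iff_sUnion_isClosed.1 hB
      (hC'.toFinset.image fun i => closure (T i)) (by simp) (by simpa using hcon)
    obtain ⟨i, hi, rfl⟩ := Finset.mem_image.1 hZ
    exact (hC'.mem_toFinset.1 hi).2 hBZ
  · rintro i hi ⟨x, hxO, hxT⟩
    by_contra hcon
    exact hxO (Set.mem_biUnion (x := i) ⟨hi, hcon⟩ (subset_closure hxT))

end Components

/-! ### Tangency along a component of the foci -/

section Tangency

variable {K : Type*} [Field K] {M N k : ℕ}

-- Containment of `φ b` in the tangent space at `x` is a closed condition on `(b, x)`: tested on the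
-- rows of a local frame of `φ`, it becomes a family of polynomial equations.
theorem IsRegularToGrass.le_embTangent [Infinite K] {Y : Set (ProjSpace K M)} {φ : Y → Grass K N k}
    (hφ : IsRegularToGrass φ) {W : Set (BiProjSpace K M N)} (hW : IsIrreducible W)
    (hWY : ∀ q ∈ W, q.1 ∈ Y) {H : MvPolynomial (Fin (M + 1) ⊕ Fin (N + 1)) K}
    (hH : H ∉ vanishingIdeal K (bicone W)) {Z : Set (ProjSpace K N)}
    (hgen : ∀ u v, Sum.elim u v ∈ bicone W → eval (Sum.elim u v) H ≠ 0 →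
      ∀ (hu : u ≠ 0) (hY : Projectivization.mk K u hu ∈ Y),
        (φ ⟨_, hY⟩).1 ≤ zariskiTangent (cone Z) v)
    {b : Y} {x : ProjSpace K N} (hq : ((b.1, x) : BiProjSpace K M N) ∈ W) :
    (φ b).1 ≤ embTangent Z x := by
  have hprime := isPrime_vanishingIdeal_bicone hW
  obtain ⟨A, _, δ, hδ, hA⟩ := hφ.exists_frame b
  have hmem : Sum.elim b.1.rep x.rep ∈ bicone W :=
    elim_mem_bicone_iff.2 ⟨b.1.rep_nonzero, x.rep_nonzero, by rwa [b.1.mk_rep, x.mk_rep]⟩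
  have hδW : rename Sum.inl δ ∉ vanishingIdeal K (bicone W) := fun hcon => hδ <| by
    have h := mem_vanishingIdeal_iff_eval.1 hcon _ hmem
    rwa [eval_rename, Sum.elim_comp_inl] at h
  have hmk := (rep_mem_cone b.2).2
  obtain ⟨⟨hAb, hspan⟩, -⟩ := hA _ b.1.rep_nonzero hmk hδ
  rw [← show φ ⟨_, hmk⟩ = φ b from congrArg φ (Subtype.ext b.1.mk_rep), hspan]
  refine Submodule.span_le.2 ?_
  rintro _ ⟨i, rfl⟩ p hp
  let Ψ : MvPolynomial (Fin (M + 1) ⊕ Fin (N + 1)) K :=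
    ∑ j, rename Sum.inl (A i j) * rename Sum.inr (pderiv j p)
  have hΨ (u v) : eval (Sum.elim u v) Ψ = ∑ j, eval u (A i j) * eval v (pderiv j p) := by
    simp only [Ψ, map_sum, map_mul, eval_rename, Sum.elim_comp_inl, Sum.elim_comp_inr]
  have hprod : H * rename Sum.inl δ * Ψ ∈ vanishingIdeal K (bicone W) := by
    refine mem_vanishingIdeal_iff_eval.2 ?_
    rintro _ ⟨u, v, hu, hv, rfl, hqW⟩
    by_contra hne
    rw [map_mul, map_mul, eval_rename, Sum.elim_comp_inl, hΨ] at hne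
    have hHδ := mul_ne_zero_iff.1 (left_ne_zero_of_mul hne)
    obtain ⟨⟨hAu, hspan⟩, -⟩ := hA u hu (hWY _ hqW) hHδ.2
    have hrow : (A.map (eval u)).row i ∈ (φ ⟨_, hWY _ hqW⟩).1 :=
      hspan ▸ Submodule.subset_span ⟨i, rfl⟩
    exact right_ne_zero_of_mul hne
      (hgen u v ⟨u, v, hu, hv, rfl, hqW⟩ hHδ.1 hu (hWY _ hqW) hrow p hp)
  have hΨW := (hprime.mem_or_mem hprod).resolve_left fun h =>
    (hprime.mem_or_mem h).elim hH hδW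
  exact (hΨ _ _).symm.trans (mem_vanishingIdeal_iff_eval.1 hΨW _ hmem)

namespace Desingularization

variable [IsAlgClosed K] {n : ℕ} {B : Set (Grass K N k)} (D : Desingularization B)
  (hB : topologicalKrullDim B ≤ (n : WithBot ℕ∞)) {W : Set (BiProjSpace K D.M N)}
  (hWf : W ⊆ D.foci)
include hB hWf

theorem le_zariskiTangent_focalLocus {u : Fin (D.M + 1) → K} {v : Fin (N + 1) → K}
    (hz : Sum.elim u v ∈ bicone W)
    (hrank : n + k ≤ finrank K
      ((zariskiTangent (bicone W) (Sum.elim u v)).map (toSpace K D.M N)))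
    (hu : u ≠ 0) (hY : Projectivization.mk K u hu ∈ D.carrier) :
    (D.toGrass ⟨_, hY⟩).1 ≤ zariskiTangent (cone D.focalLocus) v := by
  obtain ⟨_, hv, hq⟩ := elim_mem_bicone_iff.1 hz
  obtain ⟨s, hs⟩ := Projectivization.exists_smul_eq_mk_rep K u hu
  obtain ⟨t, ht⟩ := Projectivization.exists_smul_eq_mk_rep K v hv
  have hle := map_toSpace_zariskiTangent_le (W := W) s.ne_zero t.ne_zero u v
  rw [← Units.smul_def, ← Units.smul_def, hs, ht] at hle
  have hrep := D.le_embTangent_focalLocus (b := ⟨_, hY⟩) (hWf hq)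
    (D.finrank_embTangent_le hB ⟨_, hY⟩) hWf (hrank.trans (Submodule.finrank_mono hle))
  intro w hw
  have h := mem_zariskiTangent_cone_smul t⁻¹.ne_zero (hrep hw)
  rwa [← ht, ← Units.smul_def, inv_smul_smul] at h

theorem le_embTangent_of_mem [CharZero K] (hW : IsIrreducible W)
    (hdim : ((n + k : ℕ) : WithBot ℕ∞) ≤ topologicalKrullDim (D.imageInSpace W) + 1)
    {b : D.carrier} {x : ProjSpace K N} (hq : ((b.1, x) : BiProjSpace K D.M N) ∈ W) :
    (D.toGrass b).1 ≤ embTangent D.focalLocus x := by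
  obtain ⟨H, hH, hrank⟩ := exists_le_finrank_map_toSpace hW hdim
  exact D.regular.le_embTangent hW (fun q hq => (hWf hq).1.1) hH
    (fun u v hz hHz hu hY => D.le_zariskiTangent_focalLocus hB hWf hz (hrank _ hz hHz) hu hY) hq

end Desingularization

end Tangency

end Focal

end

open Focal in
theorem theorem3_general {K : Type*} [Field K] [IsAlgClosed K] [CharZero K] {N k n : ℕ}
    {B : Set (Grass K N k)} (hB_irred : IsIrreducible B)
    (hB_dim : topologicalKrullDim B ≤ (n : WithBot ℕ∞))
    (D : Desingularization B) (Φ : Set (ProjSpace K N))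
    (hF_components : ∀ W : Set (BiProjSpace K D.M N), D.IsFocalComponent W →
      B ⊆ closure (D.imageInBase W) → ¬ D.imageInSpace W ⊆ Φ →
      ((n + k : ℕ) : WithBot ℕ∞) ≤ topologicalKrullDim (D.imageInSpace W) + 1) :
    ∃ O : Set (Grass K N k), IsOpen O ∧ (B ∩ O).Nonempty ∧
      ∀ L ∈ B ∩ O, ∀ b : D.carrier, D.toGrass b = L →
        ∀ x : ProjSpace K N, ((b.1, x) : BiProjSpace K D.M N) ∈ D.foci →
          x ∉ Φ → L.1 ≤ embTangent D.focalLocus x := by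
  obtain ⟨C, hC, hmax, hfoci⟩ := exists_finite_maximal_isIrreducible D.foci
  obtain ⟨O, hO, hBO, hdom⟩ := exists_isOpen_nonempty_inter hB_irred hC D.imageInBase
  refine ⟨O, hO, hBO, ?_⟩
  rintro _ ⟨-, hbO⟩ b rfl x hq hx
  obtain ⟨W, hW, hqW⟩ := hfoci.ge hq
  have hbW : D.toGrass b ∈ D.imageInBase W := ⟨_, hqW, b.2, rfl⟩
  have hxW : x ∈ D.imageInSpace W := ⟨_, hqW, rfl⟩
  exact D.le_embTangent_of_mem hB_dim (hmax W hW).1.2 (hmax W hW).1.1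
    (hF_components W (hmax W hW) (hdom W hW ⟨_, hbO, hbW⟩) fun h => hx (h hxW)) hqW

open Focal in
theorem theorem3 {K : Type*} [Field K] [IsAlgClosed K] [CharZero K] {N k n : ℕ}
    (hn : n + k ≤ N)
    (B : Set (Grass K N k)) (hB_closed : IsClosed B) (hB_irred : IsIrreducible B)
    (hB_dim : topologicalKrullDim B = (n : WithBot ℕ∞))
    (D : Desingularization B)
    (hX_dim : topologicalKrullDim (sweptOut B) = ((n + k : ℕ) : WithBot ℕ∞))
    (hF_codim : topologicalKrullDim D.focalLocus + 1 = ((n + k : ℕ) : WithBot ℕ∞))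
    (hF_components : ∀ W : Set (BiProjSpace K D.M N), D.IsFocalComponent W →
      B ⊆ closure (D.imageInBase W) →
      ¬ D.imageInSpace W ⊆ D.fundamentalLocus →
      topologicalKrullDim (D.imageInSpace W) + 1 = ((n + k : ℕ) : WithBot ℕ∞)) :
    ∃ O : Set (Grass K N k), IsOpen O ∧ (B ∩ O).Nonempty ∧
      ∀ L ∈ B ∩ O, ∀ b : D.carrier, D.toGrass b = L →
        ∀ x : ProjSpace K N, ((b.1, x) : BiProjSpace K D.M N) ∈ D.foci →
          x ∉ D.fundamentalLocus → L.1 ≤ embTangent D.focalLocus x :=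
  theorem3_general hB_irred hB_dim.le D D.fundamentalLocus
    fun W hW hdom hΦ => (hF_components W hW hdom hΦ).ge
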